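/- Let $AdS_3$ be $SL(2,\mathbb{R})=\{X\in M(2,\mathbb{R}):\det X=1\}$ with the Lorentzian metric of signature $(-,+,+)$ induced by the quadratic form $-\det$ on $M(2,\mathbb{R})$, time-oriented by the left-invariant timelike vector field $g\mapsto gJ$, $J=\begin{pmatrix}0&1\\-1&0\end{pmatrix}$. The group $SL(2,\mathbb{R})\times SL(2,\mathbb{R})$ acts on $AdS_3$ by time-orientation preserving isometries $(g_L,g_R)\cdot g=g_Lgg_R^{-1}$. Let $A$ be the subgroup of the pairs whose two components are of the form $\mathrm{diag}(e^t,e^{-t})$, $t\in\mathbb{R}$, let $\Omega\subset AdS_3$ be the union of the $A$-orbits that are spacelike surfaces, and write $R_\theta=\begin{pmatrix}\cos\theta&\sin\theta\\-\sin\theta&\cos\theta\end{pmatrix}$ (so that $\theta$ increases towards the future along $\theta\mapsto R_\theta$). A Cauchy surface of a spacetime is a spacelike hypersurface that every inextendable non-spacelike curve meets exactly once; a spacetime is globally hyperbolic if it has a Cauchy surface. The mean curvature of a spacelike hypersurface with future-pointing unit normal $n$ is the trace of $II(X,Y)=-\langle\nabla_Xn,Y\rangle$. A CMC time function is a submersion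 $\tau$ to $\mathbb{R}$, strictly increasing along every future-directed timelike curve, such that for every $s\in\mathbb{R}$ the fiber $\tau^{-1}(s)$ is a spacelike hypersurface of constant mean curvature $s$. Theorem. Let $U$ be a connected component of $\Omega$ and $\Gamma$ a lattice of $A$. Then $\Gamma$ preserves $U$ and the Torus Universe $M=\Gamma\backslash U$, with the structure for which the local sections of $U\to M$ are charts, is a (connected, Hausdorff) spacetime locally modelled on $AdS_3$. It is globally hyperbolic and admits a CMC time function. More precisely, for every $g\in U$ the $A$-orbit of $g$ is contained in $U$ and contains $R_\theta$ for exactly one $\theta\in[0,2\pi)$; its image in $M$ is a Cauchy surface with constant mean curvature $-2\cot(2\theta)$; and the function on $M$ whose value on the image of each such orbit is $-2\cot(2\theta)$ is a CMC time function. -/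

import Mathlib

noncomputable section

open Matrix Topology
open scoped ContDiff

namespace AdS

/-! ### The anti-de Sitter space as `SL(2,ℝ)` with the metric induced by `-det` -/

/-- The ambient vector space `M(2,ℝ)` of arrays of entries `X i j`, with the usual normed structure
of `ℝ⁴` (only used to speak of derivatives). -/
abbrev Mat := Fin 2 → Fin 2 → ℝ

/-- The three-dimensional anti-de Sitter space, i.e. the quadric `-det = -1` in `Mat`. -/
abbrev AdS3 := Matrix.SpecialLinearGroup (Fin 2) ℝ

/-- The inclusion of `AdS3` in `Mat`. -/
def mat (g : AdS3) : Mat := fun i j => (g : Matrix (Fin 2) (Fin 2) ℝ) i j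

/-- The ambient quadratic form. -/
def Q (X : Mat) : ℝ := -(Matrix.of X).det

/-- The symmetric bilinear form with `B X X = Q X`. -/
def B (X Y : Mat) : ℝ := (Q (X + Y) - Q X - Q Y) / 2

/-- `X` is tangent to the quadric at `g`. -/
def IsTangent (g : AdS3) (X : Mat) : Prop := B (mat g) X = 0

/-- The left-invariant unit timelike vector field defining the time orientation; along the
rotations `R_θ` it is the velocity `d R_θ / dθ`. -/
def timeField (g : AdS3) : Mat :=
  let J : Matrix (Fin 2) (Fin 2) ℝ := !![0, 1; -1, 0]
  fun i j => ((g : Matrix (Fin 2) (Fin 2) ℝ) * J) i j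

/-- Future-directed timelike tangent vectors. -/
def IsFutureTimelike (g : AdS3) (X : Mat) : Prop :=
  IsTangent g X ∧ Q X < 0 ∧ B X (timeField g) < 0

/-- Future-directed non-spacelike (i.e. timelike or lightlike, non-zero) tangent vectors. -/
def IsFutureNonspacelike (g : AdS3) (X : Mat) : Prop :=
  IsTangent g X ∧ X ≠ 0 ∧ Q X ≤ 0 ∧ B X (timeField g) < 0

/-- The `B`-orthogonal projection of `Mat` onto the tangent space at `g` (recall `Q g = -1`). -/
def tangentProj (g : AdS3) (Y : Mat) : Mat := Y + B (mat g) Y • mat g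

/-- The Levi-Civita derivative at `g`, in the direction `X`, of a vector field `N`: the tangential
projection of the flat derivative of the ambient space. -/
def covDeriv (g : AdS3) (N : Mat → Mat) (X : Mat) : Mat :=
  tangentProj g (fderiv ℝ N (mat g) X)

/-- Velocities at `g` of curves contained in a subset `S` of `AdS3`. -/
def IsTangentTo (S : Set AdS3) (g : AdS3) (X : Mat) : Prop :=
  ∃ c : ℝ → AdS3, c 0 = g ∧ (∀ᶠ t in 𝓝 0, c t ∈ S) ∧ HasDerivAt (fun t => mat (c t)) X 0

/-- `n` is the future-pointing unit normal vector at `g` of the surface `S`. -/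
def IsFutureUnitNormal (S : Set AdS3) (g : AdS3) (n : Mat) : Prop :=
  IsFutureTimelike g n ∧ Q n = -1 ∧ ∀ X, IsTangentTo S g X → B n X = 0

/-! ### Spacetimes locally modelled on `AdS3`

`𝒜` is a set of charts of `M` with values in `AdS3`. The metric, the time orientation and the
connection of `M` are those of `AdS3`, read in these charts. -/

section Spacetime

variable {M : Type*} [TopologicalSpace M] (𝒜 : Set (OpenPartialHomeomorph M AdS3))

/-- `M` with the charts `𝒜` is a (connected, Hausdorff, second countable) time-oriented Lorentzian
manifold locally modelled on `AdS3`: the charts cover `M`, and the changes of charts are locally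
the restrictions of isometries `x ↦ g_L x g_R⁻¹`. -/
structure IsSpacetime : Prop where
  hausdorff : T2Space M
  secondCountable : SecondCountableTopology M
  connected : ConnectedSpace M
  cover : ∀ x : M, ∃ e ∈ 𝒜, x ∈ e.source
  compat : ∀ e ∈ 𝒜, ∀ e' ∈ 𝒜, ∀ x ∈ e.source ∩ e'.source,
    ∃ gL gR : AdS3, ∀ᶠ y in 𝓝 x, e' y = gL * e y * gR⁻¹

/-- `γ`, restricted to the interval `I`, is a continuous curve which, except at a locally finite
set of parameters, has a velocity of the kind `P`. -/
def IsCurveOn (P : AdS3 → Mat → Prop) (γ : ℝ → M) (I : Set ℝ) : Prop :=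
  ContinuousOn γ I ∧ ∃ S : Set ℝ, (∀ a b, (S ∩ Set.Icc a b).Finite) ∧
    ∀ t ∈ interior I, t ∉ S → ∃ e ∈ 𝒜, γ t ∈ e.source ∧
      ∃ X : Mat, HasDerivAt (fun s => mat (e (γ s))) X t ∧ P (e (γ t)) X

/-- Inextendable non-spacelike curves, future- or past-directed, without endpoint in `M`. They are
parametrized by the whole real line, as every open interval can be. -/
def IsInextendableNonspacelikeCurve (γ : ℝ → M) : Prop :=
  (IsCurveOn 𝒜 IsFutureNonspacelike γ Set.univ ∨
    IsCurveOn 𝒜 IsFutureNonspacelike (fun t => γ (-t)) Set.univ) ∧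
  (¬ ∃ x, Filter.Tendsto γ Filter.atTop (𝓝 x)) ∧ ¬ ∃ x, Filter.Tendsto γ Filter.atBot (𝓝 x)

/-- `S` is a smooth embedded spacelike surface: near each of its points it is, in a chart, the zero
set of a smooth function `f` such that the kernel of `df` on the tangent space is positive
definite (in particular `df` does not vanish on the tangent space). -/
def IsSpacelikeSurface (S : Set M) : Prop :=
  ∀ p ∈ S, ∃ e ∈ 𝒜, p ∈ e.source ∧ ∃ (W : Set Mat) (f : Mat → ℝ),
    IsOpen W ∧ mat (e p) ∈ W ∧ ContDiffOn ℝ ∞ f W ∧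
    ∀ q ∈ e.source, mat (e q) ∈ W → (q ∈ S ↔ f (mat (e q)) = 0) ∧
      (q ∈ S → ∀ X : Mat, IsTangent (e q) X → X ≠ 0 → fderiv ℝ f (mat (e q)) X = 0 → 0 < Q X)

/-- The surface `S` has mean curvature `H` at `p`: in a chart, with `N` a smooth field restricting
to the future-pointing unit normal of `S`, the form `II(X,Y) = -⟨∇_X N, Y⟩` has trace `H`, computed
in an orthonormal basis `X, Y` of the tangent plane of `S` at `p`. -/
def HasMeanCurvatureAt (S : Set M) (p : M) (H : ℝ) : Prop :=
  ∃ e ∈ 𝒜, p ∈ e.source ∧ ∃ (W : Set Mat) (N : Mat → Mat),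
    IsOpen W ∧ mat (e p) ∈ W ∧ ContDiffOn ℝ ∞ N W ∧
    (∀ q ∈ e.source, q ∈ S → mat (e q) ∈ W →
      IsFutureUnitNormal (e '' (e.source ∩ S)) (e q) (N (mat (e q)))) ∧
    ∃ X Y : Mat, IsTangentTo (e '' (e.source ∩ S)) (e p) X ∧
      IsTangentTo (e '' (e.source ∩ S)) (e p) Y ∧
      Q X = 1 ∧ Q Y = 1 ∧ B X Y = 0 ∧
      H = -B (covDeriv (e p) N X) X + -B (covDeriv (e p) N Y) Y

/-- Spacelike surfaces with constant mean curvature `H`. -/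
def IsCMCSurface (S : Set M) (H : ℝ) : Prop :=
  IsSpacelikeSurface 𝒜 S ∧ ∀ p ∈ S, HasMeanCurvatureAt 𝒜 S p H

/-- Cauchy surfaces: spacelike surfaces met exactly once by every inextendable non-spacelike
curve. -/
def IsCauchySurface (S : Set M) : Prop :=
  IsSpacelikeSurface 𝒜 S ∧
    ∀ γ : ℝ → M, IsInextendableNonspacelikeCurve 𝒜 γ → ∃! t : ℝ, γ t ∈ S

/-- Global hyperbolicity: existence of a Cauchy surface. -/
def IsGloballyHyperbolic : Prop := ∃ S : Set M, IsCauchySurface 𝒜 S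

/-- Smooth submersions to the real line (a function on the quadric is smooth if it locally extends
to a smooth function on `Mat`). -/
def IsSubmersion (τ : M → ℝ) : Prop :=
  ∀ p : M, ∃ e ∈ 𝒜, p ∈ e.source ∧ ∃ (W : Set Mat) (F : Mat → ℝ),
    IsOpen W ∧ mat (e p) ∈ W ∧ ContDiffOn ℝ ∞ F W ∧
    (∀ q ∈ e.source, mat (e q) ∈ W → τ q = F (mat (e q))) ∧
    ∃ X : Mat, IsTangent (e p) X ∧ fderiv ℝ F (mat (e p)) X ≠ 0

/-- Time functions: submersions strictly increasing along future-directed timelike curves. -/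
def IsTimeFunction (τ : M → ℝ) : Prop :=
  IsSubmersion 𝒜 τ ∧ ∀ (γ : ℝ → M) (a b : ℝ), a < b →
    IsCurveOn 𝒜 IsFutureTimelike γ (Set.Icc a b) → τ (γ a) < τ (γ b)

/-- CMC time functions: the fiber over `H` is a spacelike surface of constant mean
curvature `H`. -/
def IsCMCTimeFunction (τ : M → ℝ) : Prop :=
  IsTimeFunction 𝒜 τ ∧ ∀ H : ℝ, IsCMCSurface 𝒜 (τ ⁻¹' {H}) H

end Spacetime

/-! ### Torus Universes -/

/-- The matrix `diag (e^t, e^{-t})`. -/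
def gpow (t : ℝ) : AdS3 := ⟨!![Real.exp t, 0; 0, Real.exp (-t)], by
  rw [Matrix.det_fin_two_of, ← Real.exp_add]; simp⟩

theorem gpow_add (s t : ℝ) : gpow (s + t) = gpow s * gpow t := by
  apply Subtype.ext
  change !![Real.exp (s + t), 0; 0, Real.exp (-(s + t))] =
    !![Real.exp s, 0; 0, Real.exp (-s)] * !![Real.exp t, 0; 0, Real.exp (-t)]
  simp [Real.exp_add, mul_comm]

theorem gpow_zero : gpow 0 = 1 := by
  apply Subtype.ext
  change !![Real.exp 0, 0; 0, Real.exp (-0)] = (1 : Matrix (Fin 2) (Fin 2) ℝ)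
  simp [Matrix.one_fin_two]

/-- The one-parameter group of the matrices `diag (e^t, e^{-t})`. -/
def diagHom : Multiplicative ℝ →* AdS3 where
  toFun t := gpow t.toAdd
  map_one' := gpow_zero
  map_mul' s t := gpow_add s.toAdd t.toAdd

/-- The pairs of elements of `SL(2,ℝ)` whose two components belong to the one-parameter group. -/
def A : Subgroup (AdS3 × AdS3) := diagHom.range.prod diagHom.range

/-- The isometric action `(g_L, g_R) . g = g_L g g_R⁻¹`. -/
def act (x : AdS3 × AdS3) (g : AdS3) : AdS3 := x.1 * g * x.2⁻¹

/-- The `A`-orbit of `g`. -/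
def orbitA (g : AdS3) : Set AdS3 := {h | ∃ x ∈ A, act x g = h}

/-- The `A`-orbit of `g` is a spacelike surface: all the velocities at `g` given by the non-zero
elements `(p, q)` of the Lie algebra of `A` are spacelike. -/
def OrbitIsSpacelike (g : AdS3) : Prop :=
  ∀ p q : ℝ, (p, q) ≠ (0, 0) →
    0 < Q (deriv (fun t : ℝ => mat (act (gpow (p * t), gpow (q * t)) g)) 0)

/-- The union of the spacelike `A`-orbits. -/
def Omega : Set AdS3 := {g | ∃ h, OrbitIsSpacelike h ∧ g ∈ orbitA h}

/-- Lattices of the vector group `A`: discrete cocompact subgroups. -/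
structure IsLatticeOfA (Γ : Subgroup (AdS3 × AdS3)) : Prop where
  le : Γ ≤ A
  discrete : DiscreteTopology Γ
  cocompact : CompactSpace (A ⧸ Γ.subgroupOf A)

/-- `U` is a connected component of `Omega`. -/
def IsComponentOfOmega (U : Set AdS3) : Prop :=
  ∃ g ∈ Omega, U = connectedComponentIn Omega g

/-- Two points of `U` are equivalent if they are in the same `Γ`-orbit. -/
def orbitSetoid (Γ : Subgroup (AdS3 × AdS3)) (U : Set AdS3) : Setoid U where
  r u v := ∃ x ∈ Γ, act x u.1 = v.1
  iseqv :=
    { refl := fun u => ⟨1, Γ.one_mem, by simp [act]⟩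
      symm := by
        rintro u v ⟨x, hx, h⟩
        exact ⟨x⁻¹, Γ.inv_mem hx, by rw [← h]; simp [act, mul_assoc]⟩
      trans := by
        rintro u v w ⟨x, hx, h⟩ ⟨y, hy, h'⟩
        exact ⟨y * x, Γ.mul_mem hy hx, by rw [← h', ← h]; simp [act, mul_assoc]⟩ }

/-- The quotient `Γ \ U`, with the quotient topology. -/
abbrev TorusUniverse (Γ : Subgroup (AdS3 × AdS3)) (U : Set AdS3) := Quotient (orbitSetoid Γ U)

/-- The projection `U → Γ \ U`. -/
def proj (Γ : Subgroup (AdS3 × AdS3)) (U : Set AdS3) (u : U) : TorusUniverse Γ U :=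
  Quotient.mk (orbitSetoid Γ U) u

/-- The charts of `Γ \ U`: the local sections of the projection `U → Γ \ U`. -/
def torusCharts (Γ : Subgroup (AdS3 × AdS3)) (U : Set AdS3) :
    Set (OpenPartialHomeomorph (TorusUniverse Γ U) AdS3) :=
  {e | ∀ x ∈ e.source, ∃ u : U, proj Γ U u = x ∧ e x = u.1}

/-- The image in `Γ \ U` of the `A`-orbit of `g`. -/
def orbitImage (Γ : Subgroup (AdS3 × AdS3)) (U : Set AdS3) (g : AdS3) :
    Set (TorusUniverse Γ U) :=
  proj Γ U '' {u | u.1 ∈ orbitA g}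

/-- The rotation `R_θ`. -/
def rot (θ : ℝ) : AdS3 :=
  ⟨!![Real.cos θ, Real.sin θ; -Real.sin θ, Real.cos θ], by
    rw [Matrix.det_fin_two_of]; nlinarith [Real.sin_sq_add_cos_sq θ]⟩

end AdS

end

/-!
Every `g ∈ Ω` is `a · R_θ` for some `a = (diag (e^s, e^(-s)), diag (e^t, e^(-t))) ∈ A`. With
`x = s - t` and `y = s + t`, the functions `x`, `y` and `κ = tan θ` are coordinates on `U`; `A` acts
by translations of `x` and `y`, so the `A`-orbits in `U` are the level sets of `κ`, and also of the
increasing function `κ - κ⁻¹ = -2 cot (2θ)` of `κ`. Along each orbit the unit normal `∂_θ` is the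
restriction of a linear vector field on `M(2,ℝ)`, so the second fundamental form is read off from a
matrix; its trace is `κ - κ⁻¹`.

The four functions `κ ± x` and `-κ⁻¹ ± y` increase along every future-directed non-spacelike curve,
and their sum is `2 (κ - κ⁻¹)`. If `κ - κ⁻¹` is bounded above along such a curve, so are all four,
hence they converge, and so do `x`, `y`, `κ` and `κ⁻¹`: the curve has a limit in `U`. On an
inextendable curve `κ - κ⁻¹` therefore takes every real value once; this passes to `M` by lifting.
-/

noncomputable section

open Matrix Topology
open scoped ContDiff

namespace AdS

/-! ### Entries, and the action of the diagonal group -/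

theorem Q_eq (X : Mat) : Q X = X 0 1 * X 1 0 - X 0 0 * X 1 1 := by
  simp [Q, Matrix.det_fin_two]

theorem B_eq (X Y : Mat) :
    B X Y = (X 0 1 * Y 1 0 + Y 0 1 * X 1 0 - X 0 0 * Y 1 1 - Y 0 0 * X 1 1) / 2 := by
  simp only [B, Q_eq, Pi.add_apply]
  ring

theorem mat_det (g : AdS3) : mat g 0 0 * mat g 1 1 - mat g 0 1 * mat g 1 0 = 1 :=
  (Matrix.det_fin_two _).symm.trans g.det_coe

theorem mat_injective : Function.Injective mat := fun _ _ h => Subtype.ext h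

theorem mat_ext {X Y : Mat} (h₀₀ : X 0 0 = Y 0 0) (h₀₁ : X 0 1 = Y 0 1) (h₁₀ : X 1 0 = Y 1 0)
    (h₁₁ : X 1 1 = Y 1 1) : X = Y := by
  ext i j
  fin_cases i <;> fin_cases j <;> assumption

theorem continuous_mat : Continuous mat := continuous_subtype_val

theorem act_mul (z w : AdS3 × AdS3) (g : AdS3) : act (z * w) g = act z (act w g) := by
  simp [act, mul_assoc]

theorem act_one (g : AdS3) : act 1 g = g := by simp [act]

theorem act_inv_act (z : AdS3 × AdS3) (g : AdS3) : act z⁻¹ (act z g) = g := by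
  rw [← act_mul, inv_mul_cancel, act_one]

theorem gpow_inv (t : ℝ) : (gpow t)⁻¹ = gpow (-t) := by
  rw [inv_eq_iff_mul_eq_one, ← gpow_add, add_neg_cancel, gpow_zero]

theorem continuous_gpow : Continuous gpow := by
  refine Continuous.subtype_mk (continuous_matrix fun i j => ?_) _
  fin_cases i <;> fin_cases j
  exacts [Real.continuous_exp, continuous_const, continuous_const,
    Real.continuous_exp.comp continuous_neg]

/-- The element of `A` multiplying the entries by `e^x`, `e^y`, `e^{-y}`, `e^{-x}`. -/
def flow (x y : ℝ) : AdS3 × AdS3 := (gpow ((x + y) / 2), gpow ((y - x) / 2))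

theorem flow_sub_add (s t : ℝ) : flow (s - t) (s + t) = (gpow s, gpow t) := by
  unfold flow
  congr 2 <;> ring

theorem mem_A_iff {z : AdS3 × AdS3} : z ∈ A ↔ ∃ x y, flow x y = z := by
  constructor
  · rintro ⟨⟨s, hs⟩, ⟨t, ht⟩⟩
    exact ⟨s.toAdd - t.toAdd, s.toAdd + t.toAdd, (flow_sub_add _ _).trans (Prod.ext hs ht)⟩
  · rintro ⟨x, y, rfl⟩
    exact ⟨⟨.ofAdd _, rfl⟩, ⟨.ofAdd _, rfl⟩⟩

theorem flow_mem_A (x y : ℝ) : flow x y ∈ A := mem_A_iff.2 ⟨x, y, rfl⟩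

theorem mat_act_flow (x y : ℝ) (g : AdS3) :
    mat (act (flow x y) g) =
      ![![Real.exp x * mat g 0 0, Real.exp y * mat g 0 1],
        ![Real.exp (-y) * mat g 1 0, Real.exp (-x) * mat g 1 1]] := by
  have hl (t : ℝ) : mat (gpow t) = ![![Real.exp t, 0], ![0, Real.exp (-t)]] := rfl
  have hm (g h : AdS3) (i j : Fin 2) :
      mat (g * h) i j = mat g i 0 * mat h 0 j + mat g i 1 * mat h 1 j := by
    simp [mat, Matrix.mul_apply]
  have he (s t m : ℝ) {r : ℝ} (h : s + t = r) :
      Real.exp s * m * Real.exp t = Real.exp r * m := by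
    rw [← h, Real.exp_add]
    ring
  simp only [act, flow, gpow_inv]
  apply mat_ext <;> simpa [hm, hl] using he _ _ _ (by ring)

theorem flow_zero : flow 0 0 = 1 := by
  simp [flow, gpow_zero]

theorem continuous_flow {Z : Type*} [TopologicalSpace Z] {x y : Z → ℝ} (hx : Continuous x)
    (hy : Continuous y) : Continuous fun p => flow (x p) (y p) :=
  .prodMk (continuous_gpow.comp (by fun_prop)) (continuous_gpow.comp (by fun_prop))

theorem continuous_act {Z : Type*} [TopologicalSpace Z] {z : Z → AdS3 × AdS3} {g : Z → AdS3}
    (hz : Continuous z) (hg : Continuous g) : Continuous fun p => act (z p) (g p) := by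
  unfold act
  fun_prop

/-! ### Angle and boost coordinates -/

/-- The open set of the arrays without vanishing entry, where the coordinates below are smooth. -/
def regular : Set Mat := {m | ∀ i j, m i j ≠ 0}

theorem isOpen_regular : IsOpen regular := by
  simp only [regular, Set.ofPred_forall]
  exact isOpen_iInter_of_finite fun i => isOpen_iInter_of_finite fun j =>
    isOpen_ne_fun (by fun_prop) continuous_const

/-- The boost coordinate `x` of the array with entries `e^x cos θ`, `e^y sin θ`, `-e^{-y} sin θ`,
`e^{-x} cos θ`; as `Real.log` is even, the formula does not depend on the signs of the entries. -/
def coordX (m : Mat) : ℝ := (Real.log (m 0 0) - Real.log (m 1 1)) / 2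

/-- The boost coordinate `y` of the array with entries `e^x cos θ`, `e^y sin θ`, `-e^{-y} sin θ`,
`e^{-x} cos θ`. -/
def coordY (m : Mat) : ℝ := (Real.log (m 0 1) - Real.log (m 1 0)) / 2

/-- The invariant `tan θ` of the array with entries `e^x cos θ`, `e^y sin θ`, `-e^{-y} sin θ`,
`e^{-x} cos θ`. -/
def tanAngle (m : Mat) : ℝ := m 0 1 / m 0 0 * Real.exp (coordX m - coordY m)

/-- The quantity `tan θ - (tan θ)⁻¹ = -2 cot 2θ`, the mean curvature of the `A`-orbit of `m`. -/
def meanCurv (m : Mat) : ℝ := tanAngle m - (tanAngle m)⁻¹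

theorem contDiffOn_coordX : ContDiffOn ℝ ∞ coordX regular := by
  unfold coordX
  exact ((ContDiffOn.log (by fun_prop) fun m (hm : m ∈ regular) => hm 0 0).sub
    (ContDiffOn.log (by fun_prop) fun m (hm : m ∈ regular) => hm 1 1)).div_const 2

theorem contDiffOn_coordY : ContDiffOn ℝ ∞ coordY regular := by
  unfold coordY
  exact ((ContDiffOn.log (by fun_prop) fun m (hm : m ∈ regular) => hm 0 1).sub
    (ContDiffOn.log (by fun_prop) fun m (hm : m ∈ regular) => hm 1 0)).div_const 2

theorem contDiffOn_tanAngle : ContDiffOn ℝ ∞ tanAngle regular := by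
  unfold tanAngle
  exact (ContDiffOn.div (by fun_prop) (by fun_prop) fun m (hm : m ∈ regular) => hm 0 0).mul
    (contDiffOn_coordX.sub contDiffOn_coordY).exp

theorem tanAngle_ne_zero {m : Mat} (hm : m ∈ regular) : tanAngle m ≠ 0 :=
  mul_ne_zero (div_ne_zero (hm 0 1) (hm 0 0)) (Real.exp_ne_zero _)

theorem contDiffOn_meanCurv : ContDiffOn ℝ ∞ meanCurv regular :=
  contDiffOn_tanAngle.sub (contDiffOn_tanAngle.inv fun _ => tanAngle_ne_zero)

section Action

variable {g : AdS3} (x y : ℝ)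

theorem coordX_act_flow (hg : mat g ∈ regular) :
    coordX (mat (act (flow x y) g)) = coordX (mat g) + x := by
  simp [coordX, mat_act_flow, Real.log_mul, hg 0 0, hg 1 1]
  ring

theorem coordY_act_flow (hg : mat g ∈ regular) :
    coordY (mat (act (flow x y) g)) = coordY (mat g) + y := by
  simp [coordY, mat_act_flow, Real.log_mul, hg 0 1, hg 1 0]
  ring

theorem tanAngle_act_flow (hg : mat g ∈ regular) :
    tanAngle (mat (act (flow x y) g)) = tanAngle (mat g) := by
  rw [tanAngle, coordX_act_flow x y hg, coordY_act_flow x y hg]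
  simp only [mat_act_flow, tanAngle, Real.exp_sub, Real.exp_add, Matrix.cons_val_zero,
    Matrix.cons_val_one]
  field_simp

theorem meanCurv_act_flow (hg : mat g ∈ regular) :
    meanCurv (mat (act (flow x y) g)) = meanCurv (mat g) := by
  rw [meanCurv, tanAngle_act_flow x y hg, meanCurv]

end Action

/-! ### The frame of coordinate vector fields -/

/-- The combination `ζ ∂_θ + ξ ∂_x + η ∂_y` of the coordinate vector fields. -/
def frame (m : Mat) (ζ ξ η : ℝ) : Mat :=
  ![![m 0 0 * (ξ - tanAngle m * ζ), m 0 1 * (η + (tanAngle m)⁻¹ * ζ)],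
    ![m 1 0 * (-η + (tanAngle m)⁻¹ * ζ), m 1 1 * (-ξ - tanAngle m * ζ)]]

/-- The product `ad` of the diagonal entries, which is `cos² θ`. -/
def cosSq (g : AdS3) : ℝ := mat g 0 0 * mat g 1 1

/-- The opposite `-bc` of the product of the antidiagonal entries, which is `sin² θ`. -/
def sinSq (g : AdS3) : ℝ := -(mat g 0 1 * mat g 1 0)

theorem cosSq_add_sinSq (g : AdS3) : cosSq g + sinSq g = 1 := by
  rw [cosSq, sinSq, ← sub_eq_add_neg, mat_det]

theorem hasDerivAt_act_flow (g : AdS3) (ξ η : ℝ) :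
    HasDerivAt (fun t : ℝ => mat (act (flow (ξ * t) (η * t)) g)) (frame (mat g) 0 ξ η) 0 := by
  have key (r m : ℝ) : HasDerivAt (fun t : ℝ => Real.exp (r * t) * m) (m * r) 0 := by
    simpa [mul_comm] using (((hasDerivAt_id (0 : ℝ)).const_mul r).exp).mul_const m
  simp only [mat_act_flow, ← neg_mul]
  refine hasDerivAt_pi.2 fun i => hasDerivAt_pi.2 fun j => ?_
  fin_cases i <;> fin_cases j
  · simpa [frame] using key ξ (mat g 0 0)
  · simpa [frame] using key η (mat g 0 1)
  · simpa [frame] using key (-η) (mat g 1 0)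
  · simpa [frame] using key (-ξ) (mat g 1 1)

theorem Q_frame_zero (g : AdS3) (ξ η : ℝ) :
    Q (frame (mat g) 0 ξ η) = cosSq g * ξ ^ 2 + sinSq g * η ^ 2 := by
  simp [Q_eq, frame, cosSq, sinSq]
  ring

theorem orbitIsSpacelike_iff (g : AdS3) : OrbitIsSpacelike g ↔ 0 < cosSq g ∧ 0 < sinSq g := by
  have hQ (p q : ℝ) : Q (deriv (fun t : ℝ => mat (act (gpow (p * t), gpow (q * t)) g)) 0) =
      cosSq g * (p - q) ^ 2 + sinSq g * (p + q) ^ 2 := by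
    simp only [← flow_sub_add, ← sub_mul, ← add_mul, (hasDerivAt_act_flow g _ _).deriv,
      Q_frame_zero]
  simp only [OrbitIsSpacelike, hQ]
  refine ⟨fun h => ⟨?_, ?_⟩, fun ⟨hc, hs⟩ p q hpq => ?_⟩
  · linarith [h 1 (-1) (by simp)]
  · linarith [h 1 1 (by simp)]
  · rcases ne_or_eq p q with h | rfl
    · have := sub_ne_zero.2 h
      positivity
    · have : p + p ≠ 0 := by simpa using hpq
      positivity

theorem cosSq_act_flow (x y : ℝ) (g : AdS3) : cosSq (act (flow x y) g) = cosSq g := by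
  simp [cosSq, mat_act_flow, Real.exp_neg]
  field_simp

theorem sinSq_act_flow (x y : ℝ) (g : AdS3) : sinSq (act (flow x y) g) = sinSq g := by
  simp [sinSq, mat_act_flow, Real.exp_neg]
  field_simp

theorem mem_Omega_iff {g : AdS3} : g ∈ Omega ↔ 0 < cosSq g ∧ 0 < sinSq g := by
  constructor
  · rintro ⟨h, hh, z, hz, rfl⟩
    obtain ⟨x, y, rfl⟩ := mem_A_iff.1 hz
    rwa [cosSq_act_flow, sinSq_act_flow, ← orbitIsSpacelike_iff]
  · exact fun h => ⟨g, (orbitIsSpacelike_iff g).2 h, 1, one_mem _, act_one g⟩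

section Omega

variable {g : AdS3} (hg : g ∈ Omega)
include hg

theorem mat_mem_regular : mat g ∈ regular := by
  obtain ⟨hc, hs⟩ := mem_Omega_iff.1 hg
  have hs' := (neg_pos.1 hs).ne
  intro i j
  fin_cases i <;> fin_cases j
  exacts [left_ne_zero_of_mul hc.ne', left_ne_zero_of_mul hs', right_ne_zero_of_mul hs',
    right_ne_zero_of_mul hc.ne']

theorem act_mem_Omega {z : AdS3 × AdS3} (hz : z ∈ A) : act z g ∈ Omega := by
  obtain ⟨x, y, rfl⟩ := mem_A_iff.1 hz
  rwa [mem_Omega_iff, cosSq_act_flow, sinSq_act_flow, ← mem_Omega_iff]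

theorem exp_coordX_sq : Real.exp (coordX (mat g)) ^ 2 = mat g 0 0 / mat g 1 1 := by
  have hc := (mem_Omega_iff.1 hg).1
  have hr := mat_mem_regular hg
  have hpos : 0 < mat g 0 0 / mat g 1 1 := by
    rw [cosSq] at hc
    exact div_pos_iff.2 (mul_pos_iff.1 hc)
  rw [← Real.exp_nat_mul, coordX, ← Real.log_div (hr 0 0) (hr 1 1), Nat.cast_ofNat,
    mul_div_cancel₀ _ two_ne_zero, Real.exp_log hpos]

theorem exp_coordY_sq : Real.exp (coordY (mat g)) ^ 2 = -mat g 0 1 / mat g 1 0 := by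
  have hs := (mem_Omega_iff.1 hg).2
  have hr := mat_mem_regular hg
  have hpos : 0 < -mat g 0 1 / mat g 1 0 := by
    rw [sinSq, ← neg_mul] at hs
    exact div_pos_iff.2 (mul_pos_iff.1 hs)
  rw [← Real.exp_nat_mul, coordY, ← Real.log_div (hr 0 1) (hr 1 0), Nat.cast_ofNat,
    mul_div_cancel₀ _ two_ne_zero, ← Real.log_neg_eq_log, ← neg_div, Real.exp_log hpos]

theorem sinSq_eq : sinSq g = tanAngle (mat g) ^ 2 * cosSq g := by
  have hr := mat_mem_regular hg
  have h00 := hr 0 0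
  have h01 := hr 0 1
  have h10 := hr 1 0
  have h11 := hr 1 1
  rw [tanAngle, Real.exp_sub, mul_pow, div_pow, div_pow, exp_coordX_sq hg, exp_coordY_sq hg,
    sinSq, cosSq]
  field_simp

theorem one_add_tanAngle_sq_mul_cosSq : (1 + tanAngle (mat g) ^ 2) * cosSq g = 1 := by
  linear_combination cosSq_add_sinSq g - sinSq_eq hg

end Omega

section Derivatives

variable {c : ℝ → Mat} {t ζ ξ η : ℝ} (hm : c t ∈ regular)
  (hc : HasDerivAt c (frame (c t) ζ ξ η) t)
include hm hc

theorem hasDerivAt_coordX : HasDerivAt (fun s => coordX (c s)) ξ t := by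
  have hentry (i j) := hasDerivAt_pi.1 (hasDerivAt_pi.1 hc i) j
  convert! (((hentry 0 0).log (hm 0 0)).sub ((hentry 1 1).log (hm 1 1))).div_const 2 using 1
  have := hm 0 0
  have := hm 1 1
  simp only [frame, Matrix.cons_val_zero, Matrix.cons_val_one]
  field_simp
  ring

theorem hasDerivAt_coordY : HasDerivAt (fun s => coordY (c s)) η t := by
  have hentry (i j) := hasDerivAt_pi.1 (hasDerivAt_pi.1 hc i) j
  convert! (((hentry 0 1).log (hm 0 1)).sub ((hentry 1 0).log (hm 1 0))).div_const 2 using 1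
  have := hm 0 1
  have := hm 1 0
  simp only [frame, Matrix.cons_val_zero, Matrix.cons_val_one]
  field_simp
  ring

theorem hasDerivAt_tanAngle :
    HasDerivAt (fun s => tanAngle (c s)) ((1 + tanAngle (c t) ^ 2) * ζ) t := by
  have hentry (i j) := hasDerivAt_pi.1 (hasDerivAt_pi.1 hc i) j
  convert! ((hentry 0 1).div (hentry 0 0) (hm 0 0)).mul
    ((hasDerivAt_coordX hm hc).sub (hasDerivAt_coordY hm hc)).exp using 1
  have := hm 0 0
  have := hm 0 1
  have := Real.exp_ne_zero (coordX (c t) - coordY (c t))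
  simp only [frame, tanAngle, Matrix.cons_val_zero, Matrix.cons_val_one, Pi.sub_apply, Pi.div_apply]
  field_simp
  ring

theorem hasDerivAt_neg_inv_tanAngle :
    HasDerivAt (fun s => -(tanAngle (c s))⁻¹) ((1 + (tanAngle (c t) ^ 2)⁻¹) * ζ) t := by
  have := tanAngle_ne_zero hm
  convert! ((hasDerivAt_tanAngle hm hc).inv this).neg using 1
  field_simp
  ring

theorem hasDerivAt_meanCurv :
    HasDerivAt (fun s => meanCurv (c s))
      ((2 + tanAngle (c t) ^ 2 + (tanAngle (c t) ^ 2)⁻¹) * ζ) t := by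
  convert! (hasDerivAt_tanAngle hm hc).add (hasDerivAt_neg_inv_tanAngle hm hc) using 1
  ring

end Derivatives

theorem fderiv_meanCurv_frame {m : Mat} (hm : m ∈ regular) (ζ ξ η : ℝ) :
    fderiv ℝ meanCurv m (frame m ζ ξ η) = (2 + tanAngle m ^ 2 + (tanAngle m ^ 2)⁻¹) * ζ := by
  have hline : HasDerivAt (fun t : ℝ => m + t • frame m ζ ξ η) (frame m ζ ξ η) 0 := by
    simpa using ((hasDerivAt_id (0 : ℝ)).smul_const (frame m ζ ξ η)).const_add m
  have hdiff : DifferentiableAt ℝ meanCurv m :=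
    (contDiffOn_meanCurv.contDiffAt (isOpen_regular.mem_nhds hm)).differentiableAt (by simp)
  have hcomp := HasFDerivAt.comp_hasDerivAt_of_eq 0 hdiff.hasFDerivAt hline (by simp)
  have hmean := hasDerivAt_meanCurv (c := fun t : ℝ => m + t • frame m ζ ξ η) (t := 0)
    (ζ := ζ) (ξ := ξ) (η := η) (by simpa using hm) (by simpa using hline)
  simpa using hcomp.unique hmean

/-! ### The metric and the future cone in the frame -/

theorem isTangent_frame {g : AdS3} (hg : g ∈ Omega) (ζ ξ η : ℝ) :
    IsTangent g (frame (mat g) ζ ξ η) := by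
  have hκ := tanAngle_ne_zero (mat_mem_regular hg)
  have hs := sinSq_eq hg
  rw [cosSq, sinSq] at hs
  simp only [IsTangent, B_eq, frame, Matrix.cons_val_zero, Matrix.cons_val_one]
  field_simp
  linear_combination (-2 * ζ) * hs

theorem isTangent_iff_exists_frame {g : AdS3} (hg : g ∈ Omega) {X : Mat} :
    IsTangent g X ↔ ∃ ζ ξ η, frame (mat g) ζ ξ η = X := by
  refine ⟨fun hX => ?_, fun ⟨ζ, ξ, η, h⟩ => h ▸ isTangent_frame hg ζ ξ η⟩
  have hr := mat_mem_regular hg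
  have hκ := tanAngle_ne_zero hr
  have h00 := hr 0 0
  have h01 := hr 0 1
  have h10 := hr 1 0
  have h11 := hr 1 1
  have hs := sinSq_eq hg
  rw [cosSq, sinSq] at hs
  rw [IsTangent, B_eq] at hX
  set r := (mat g 1 1 * X 0 0 + mat g 0 0 * X 1 1) / 2 with hr
  have hκζ : tanAngle (mat g) * (-r / (tanAngle (mat g) * cosSq g)) =
      -r / (mat g 0 0 * mat g 1 1) := by
    rw [cosSq]
    field_simp
  have hκζ' : (tanAngle (mat g))⁻¹ * (-r / (tanAngle (mat g) * cosSq g)) =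
      r / (mat g 0 1 * mat g 1 0) := by
    rw [cosSq]
    field_simp
    linear_combination r * hs
  refine ⟨-r / (tanAngle (mat g) * cosSq g), X 0 0 / mat g 0 0 - r / (mat g 0 0 * mat g 1 1),
    X 0 1 / mat g 0 1 - r / (mat g 0 1 * mat g 1 0), ?_⟩
  simp only [frame, hκζ, hκζ']
  apply mat_ext <;> simp only [Matrix.cons_val_zero, Matrix.cons_val_one] <;> field_simp
  · ring
  · ring
  · linear_combination 2 * hr - 2 * hX
  · linear_combination 2 * hr

theorem B_frame {g : AdS3} (hg : g ∈ Omega) (ζ ξ η ζ' ξ' η' : ℝ) :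
    B (frame (mat g) ζ ξ η) (frame (mat g) ζ' ξ' η') =
      -(ζ * ζ') + cosSq g * (ξ * ξ') + sinSq g * (η * η') := by
  have hκ := tanAngle_ne_zero (mat_mem_regular hg)
  have hs := sinSq_eq hg
  have hc := one_add_tanAngle_sq_mul_cosSq hg
  rw [show B (frame (mat g) ζ ξ η) (frame (mat g) ζ' ξ' η') =
      -(cosSq g * tanAngle (mat g) ^ 2 + sinSq g / tanAngle (mat g) ^ 2) * (ζ * ζ') +
        cosSq g * (ξ * ξ') + sinSq g * (η * η') by
    simp only [B_eq, frame, cosSq, sinSq, Matrix.cons_val_zero, Matrix.cons_val_one]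
    field_simp
    ring, hs, mul_div_cancel_left₀ _ (pow_ne_zero 2 hκ)]
  linear_combination (-(ζ * ζ')) * hc

theorem Q_eq_B (X : Mat) : Q X = B X X := by
  rw [B_eq, Q_eq]
  ring

theorem Q_frame {g : AdS3} (hg : g ∈ Omega) (ζ ξ η : ℝ) :
    Q (frame (mat g) ζ ξ η) = -ζ ^ 2 + cosSq g * ξ ^ 2 + sinSq g * η ^ 2 := by
  rw [Q_eq_B, B_frame hg]
  ring

theorem tanAngle_mul_apply_zero_zero {g : AdS3} (hg : g ∈ Omega) :
    tanAngle (mat g) * mat g 0 0 = mat g 0 1 * Real.exp (coordX (mat g) - coordY (mat g)) := by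
  have := mat_mem_regular hg 0 0
  rw [tanAngle]
  field_simp

theorem tanAngle_mul_apply_one_one {g : AdS3} (hg : g ∈ Omega) :
    tanAngle (mat g) * mat g 1 1 = -mat g 1 0 * Real.exp (coordY (mat g) - coordX (mat g)) := by
  have hr := mat_mem_regular hg
  have := hr 0 0
  have := hr 1 0
  have := hr 1 1
  have hx := exp_coordX_sq hg
  have hy := exp_coordY_sq hg
  rw [tanAngle, Real.exp_sub, Real.exp_sub]
  field_simp at hx hy ⊢
  rw [hx]
  linear_combination mat g 0 0 * hy

theorem timeField_eq_frame {g : AdS3} (hg : g ∈ Omega) {u : ℝ}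
    (hu : u = coordY (mat g) - coordX (mat g)) :
    timeField g = frame (mat g) (Real.cosh u) (-(tanAngle (mat g) * Real.sinh u))
      (-((tanAngle (mat g))⁻¹ * Real.sinh u)) := by
  have hκ := tanAngle_ne_zero (mat_mem_regular hg)
  have h₀ : tanAngle (mat g) * mat g 0 0 * Real.exp u = mat g 0 1 := by
    rw [tanAngle_mul_apply_zero_zero hg, mul_assoc, ← Real.exp_add]
    simp [hu]
  have h₁ : tanAngle (mat g) * mat g 1 1 * Real.exp (-u) = -mat g 1 0 := by
    rw [tanAngle_mul_apply_one_one hg, mul_assoc, ← Real.exp_add]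
    simp [hu]
  have he : Real.exp u * Real.exp (-u) = 1 := by simp [← Real.exp_add]
  have hT : timeField g = ![![-mat g 0 1, mat g 0 0], ![-mat g 1 1, mat g 1 0]] := by
    apply mat_ext <;> simp [timeField, mat, Matrix.mul_apply]
  rw [hT]
  apply mat_ext <;>
    simp only [frame, Real.cosh_eq, Real.sinh_eq, Matrix.cons_val_zero, Matrix.cons_val_one]
  · linear_combination h₀
  · field_simp
    linear_combination 2 * Real.exp (-u) * h₀ - 2 * tanAngle (mat g) * mat g 0 0 * he
  · field_simp
    linear_combination 2 * tanAngle (mat g) * mat g 1 1 * he - 2 * Real.exp u * h₁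
  · linear_combination h₁

theorem IsFutureTimelike.isFutureNonspacelike {g : AdS3} {X : Mat} (hX : IsFutureTimelike g X) :
    IsFutureNonspacelike g X := by
  refine ⟨hX.1, ?_, hX.2.1.le, hX.2.2⟩
  rintro rfl
  simpa [Q_eq] using hX.2.1

theorem pos_of_isFutureNonspacelike_frame {g : AdS3} (hg : g ∈ Omega) {ζ ξ η : ℝ}
    (hX : IsFutureNonspacelike g (frame (mat g) ζ ξ η)) : 0 < ζ := by
  obtain ⟨-, -, hQ, hB⟩ := hX
  have hκ := tanAngle_ne_zero (mat_mem_regular hg)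
  set u := coordY (mat g) - coordX (mat g) with hu
  set w := cosSq g * tanAngle (mat g) * (ξ + η) with hw
  rw [Q_frame hg] at hQ
  have hs := sinSq_eq hg
  have hc := one_add_tanAngle_sq_mul_cosSq hg
  have hfuture : 0 < ζ * Real.cosh u + w * Real.sinh u := by
    rw [timeField_eq_frame hg hu, B_frame hg, hs] at hB
    field_simp at hB
    linarith
  have hCauchySchwarz : w ^ 2 ≤ ζ ^ 2 := by
    have hsq : cosSq g * ξ ^ 2 + sinSq g * η ^ 2 - w ^ 2 =
        (cosSq g * ξ - sinSq g * η) ^ 2 := by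
      rw [hw, hs]
      linear_combination (-(cosSq g) * (ξ ^ 2 + tanAngle (mat g) ^ 2 * η ^ 2)) * hc
    nlinarith [sq_nonneg (cosSq g * ξ - sinSq g * η)]
  by_contra! hζ
  have habs : |w| ≤ -ζ := (sq_le_sq.1 hCauchySchwarz).trans_eq (abs_of_nonpos hζ)
  have hsinh : |Real.sinh u| ≤ Real.cosh u := by
    rw [Real.abs_sinh, ← Real.cosh_abs]
    exact (Real.sinh_lt_cosh _).le
  have := mul_le_mul habs hsinh (abs_nonneg _) (by linarith)
  rw [← abs_mul] at this
  linarith [le_abs_self (w * Real.sinh u)]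

/-- The time component dominates the others strictly, as `cos² θ` and `sin² θ` are less than `1`. -/
theorem exists_frame_of_isFutureNonspacelike {g : AdS3} (hg : g ∈ Omega) {X : Mat}
    (hX : IsFutureNonspacelike g X) :
    ∃ ζ ξ η, frame (mat g) ζ ξ η = X ∧ 0 < ζ ∧ |ξ| < (1 + tanAngle (mat g) ^ 2) * ζ ∧
      |η| < (1 + (tanAngle (mat g) ^ 2)⁻¹) * ζ := by
  obtain ⟨ζ, ξ, η, rfl⟩ := (isTangent_iff_exists_frame hg).1 hX.1
  have hζ := pos_of_isFutureNonspacelike_frame hg hX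
  have hκ := tanAngle_ne_zero (mat_mem_regular hg)
  have hκ' : 0 < tanAngle (mat g) ^ 2 := by positivity
  have hQ := hX.2.2.1
  rw [Q_frame hg] at hQ
  obtain ⟨hc, hs⟩ := mem_Omega_iff.1 hg
  have hc' := one_add_tanAngle_sq_mul_cosSq hg
  have hs' : (1 + (tanAngle (mat g) ^ 2)⁻¹) * sinSq g = 1 := by
    rw [sinSq_eq hg]
    field_simp
    linear_combination hc'
  have hbound {r p v : ℝ} (hr : 0 < r) (hrp : (1 + r) * p = 1) (hv : p * v ^ 2 ≤ ζ ^ 2) :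
      |v| < (1 + r) * ζ := by
    refine abs_lt_of_sq_lt_sq ?_ (by positivity)
    calc v ^ 2 = (1 + r) * (p * v ^ 2) := by linear_combination (-v ^ 2) * hrp
      _ ≤ (1 + r) * ζ ^ 2 := by gcongr
      _ < ((1 + r) * ζ) ^ 2 := by nlinarith [mul_pos hr (pow_pos hζ 2)]
  refine ⟨ζ, ξ, η, rfl, hζ, hbound hκ' hc' ?_, hbound (inv_pos.2 hκ') hs' ?_⟩
  · linarith [mul_nonneg hs.le (sq_nonneg η)]
  · linarith [mul_nonneg hc.le (sq_nonneg ξ)]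

/-- Four functions that increase along all future-directed causal curves; their bounds along such a
curve control the four quantities `tan θ`, `cot θ`, `x`, `y`. -/
def causalCoord (m : Mat) : Fin 4 → ℝ :=
  ![tanAngle m + coordX m, tanAngle m - coordX m,
    -(tanAngle m)⁻¹ + coordY m, -(tanAngle m)⁻¹ - coordY m]

theorem sum_causalCoord (m : Mat) : ∑ i, causalCoord m i = 2 * meanCurv m := by
  simp only [Fin.sum_univ_four, causalCoord, meanCurv, Matrix.cons_val]
  ring

theorem contDiffOn_causalCoord (i : Fin 4) : ContDiffOn ℝ ∞ (fun m => causalCoord m i) regular := by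
  have hκ := contDiffOn_tanAngle
  have hκ' := (contDiffOn_tanAngle.inv fun _ => tanAngle_ne_zero).neg
  have hx := contDiffOn_coordX
  have hy := contDiffOn_coordY
  fin_cases i
  exacts [hκ.add hx, hκ.sub hx, hκ'.add hy, hκ'.sub hy]

theorem causalCoord_act_flow {g : AdS3} (hg : mat g ∈ regular) (x y : ℝ) (i : Fin 4) :
    causalCoord (mat (act (flow x y) g)) i = causalCoord (mat g) i + ![x, -x, y, -y] i := by
  have hκ := tanAngle_act_flow x y hg
  have hx := coordX_act_flow x y hg
  have hy := coordY_act_flow x y hg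
  simp only [causalCoord, hκ, hx, hy]
  fin_cases i
  exacts [(add_assoc ..).symm, sub_add_eq_sub_sub .., (add_assoc ..).symm, sub_add_eq_sub_sub ..]

theorem exists_hasDerivAt_causalCoord {c : ℝ → Mat} {t : ℝ} {g : AdS3} (hg : g ∈ Omega)
    (hgt : mat g = c t) {X : Mat} (hX : IsFutureNonspacelike g X) (hc : HasDerivAt c X t)
    (i : Fin 4) : ∃ r > 0, HasDerivAt (fun s => causalCoord (c s) i) r t := by
  have hm := mat_mem_regular hg
  obtain ⟨ζ, ξ, η, rfl, -, hξ, hη⟩ := exists_frame_of_isFutureNonspacelike hg hX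
  rw [hgt] at hm hξ hη hc
  rw [abs_lt] at hξ hη
  have hx := hasDerivAt_coordX hm hc
  have hy := hasDerivAt_coordY hm hc
  have hκ := hasDerivAt_tanAngle hm hc
  have hκ' := hasDerivAt_neg_inv_tanAngle hm hc
  fin_cases i
  exacts [⟨_, by linarith, hκ.add hx⟩, ⟨_, by linarith, hκ.sub hx⟩,
    ⟨_, by linarith, hκ'.add hy⟩, ⟨_, by linarith, hκ'.sub hy⟩]

/-! ### Rotations and polar coordinates -/

theorem mat_rot (θ : ℝ) :
    mat (rot θ) = ![![Real.cos θ, Real.sin θ], ![-Real.sin θ, Real.cos θ]] := rfl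

theorem continuous_rot : Continuous rot := by
  refine Continuous.subtype_mk (continuous_matrix fun i j => ?_) _
  fin_cases i <;> fin_cases j
  exacts [Real.continuous_cos, Real.continuous_sin, Real.continuous_sin.neg, Real.continuous_cos]

theorem rot_periodic : Function.Periodic rot (2 * Real.pi) := fun θ =>
  mat_injective (by simp [mat_rot])

theorem rot_injOn : Set.InjOn rot (Set.Ico 0 (2 * Real.pi)) := by
  intro θ hθ φ hφ h
  have hmat := congrArg mat h
  have hc : Real.cos θ = Real.cos φ := congrFun₂ hmat 0 0
  have hs : Real.sin θ = Real.sin φ := congrFun₂ hmat 0 1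
  have : Fact (0 < 2 * Real.pi) := ⟨Real.two_pi_pos⟩
  exact (AddCircle.coe_eq_coe_iff_of_mem_Ico (a := 0) (by simpa using hθ) (by simpa using hφ)).1
    (Real.Angle.cos_sin_inj hc hs)

theorem coordX_rot (θ : ℝ) : coordX (mat (rot θ)) = 0 := by simp [coordX, mat_rot]

theorem coordY_rot (θ : ℝ) : coordY (mat (rot θ)) = 0 := by simp [coordY, mat_rot]

theorem tanAngle_rot (θ : ℝ) : tanAngle (mat (rot θ)) = Real.tan θ := by
  rw [tanAngle, coordX_rot, coordY_rot, sub_zero, Real.exp_zero, mul_one, Real.tan_eq_sin_div_cos]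
  rfl

theorem rot_mem_Omega_iff {θ : ℝ} : rot θ ∈ Omega ↔ Real.tan θ ≠ 0 := by
  rw [mem_Omega_iff, Real.tan_eq_sin_div_cos, div_ne_zero_iff, and_comm]
  simp [cosSq, sinSq, mat_rot]

theorem meanCurv_rot {θ : ℝ} (hθ : rot θ ∈ Omega) :
    meanCurv (mat (rot θ)) = -2 * Real.cot (2 * θ) := by
  rw [rot_mem_Omega_iff, Real.tan_eq_sin_div_cos, div_ne_zero_iff] at hθ
  obtain ⟨hs, hc⟩ := hθ
  rw [meanCurv, tanAngle_rot, Real.tan_eq_sin_div_cos, Real.cot_eq_cos_div_sin, Real.cos_two_mul',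
    Real.sin_two_mul]
  field_simp
  ring

/-- The half-turn to be added to `arctan (tan θ)` in order to obtain `θ`, up to full turns. -/
def halfTurn (g : AdS3) : ℝ := if 0 < mat g 0 0 then 0 else Real.pi

theorem tan_arctan_add_halfTurn (κ : ℝ) (g : AdS3) :
    Real.tan (Real.arctan κ + halfTurn g) = κ := by
  unfold halfTurn
  split_ifs <;> simp [Real.tan_periodic _]

theorem cos_arctan_add_halfTurn {g : AdS3} (hg : g ∈ Omega) :
    Real.cos (Real.arctan (tanAngle (mat g)) + halfTurn g) =
      SignType.sign (mat g 0 0) * √(cosSq g) := by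
  have hc := (eq_inv_of_mul_eq_one_right (one_add_tanAngle_sq_mul_cosSq hg))
  have h : Real.cos (Real.arctan (tanAngle (mat g))) = √(cosSq g) := by
    rw [Real.cos_arctan, hc, Real.sqrt_inv, one_div]
  have := mat_mem_regular hg 0 0
  unfold halfTurn
  split_ifs with h0
  · simp [h, sign_pos h0]
  · simp [h, sign_neg (lt_of_le_of_ne (not_lt.1 h0) this)]

theorem act_flow_rot {g : AdS3} (hg : g ∈ Omega) :
    act (flow (coordX (mat g)) (coordY (mat g)))
      (rot (Real.arctan (tanAngle (mat g)) + halfTurn g)) = g := by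
  set θ := Real.arctan (tanAngle (mat g)) + halfTurn g with hθ
  have hr := mat_mem_regular hg
  have h00 := hr 0 0
  have h01 := hr 0 1
  have h10 := hr 1 0
  have h11 := hr 1 1
  have hx := exp_coordX_sq hg
  have hy := exp_coordY_sq hg
  have hcos : Real.exp (coordX (mat g)) * Real.cos θ = mat g 0 0 := by
    have habs : Real.exp (coordX (mat g)) * √(cosSq g) = |mat g 0 0| := by
      rw [← Real.sqrt_sq (Real.exp_pos (coordX (mat g))).le, hx, ← Real.sqrt_sq_eq_abs,
        ← Real.sqrt_mul' _ (mem_Omega_iff.1 hg).1.le, cosSq]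
      congr 1
      field_simp
    rw [cos_arctan_add_halfTurn hg, mul_left_comm, habs, sign_mul_abs]
  have hsin : Real.exp (coordY (mat g)) * Real.sin θ = mat g 0 1 := by
    have hcos0 : Real.cos θ ≠ 0 := right_ne_zero_of_mul (hcos.trans_ne h00)
    have htan := tan_arctan_add_halfTurn (tanAngle (mat g)) g
    rw [← hθ, Real.tan_eq_sin_div_cos, div_eq_iff hcos0, tanAngle, Real.exp_sub] at htan
    rw [htan]
    field_simp
    exact hcos
  apply mat_injective
  apply mat_ext <;>
    simp only [mat_act_flow, mat_rot, Real.exp_neg, Matrix.cons_val_zero, Matrix.cons_val_one]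
  · exact hcos
  · exact hsin
  · calc _ = -(Real.exp (coordY (mat g)) * Real.sin θ) / Real.exp (coordY (mat g)) ^ 2 := by
          field_simp
      _ = mat g 1 0 := by rw [hsin, hy]; field_simp
  · calc _ = Real.exp (coordX (mat g)) * Real.cos θ / Real.exp (coordX (mat g)) ^ 2 := by
          field_simp
      _ = mat g 1 1 := by rw [hcos, hx]; field_simp

/-! ### Orbits -/

theorem mem_orbitA_symm {g h : AdS3} (hh : h ∈ orbitA g) : g ∈ orbitA h := by
  obtain ⟨z, hz, rfl⟩ := hh
  exact ⟨z⁻¹, A.inv_mem hz, act_inv_act z g⟩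

theorem mem_orbitA_trans {f g h : AdS3} (hg : g ∈ orbitA f) (hh : h ∈ orbitA g) :
    h ∈ orbitA f := by
  obtain ⟨z, hz, rfl⟩ := hg
  obtain ⟨w, hw, rfl⟩ := hh
  exact ⟨w * z, A.mul_mem hw hz, act_mul w z f⟩

theorem rot_mem_orbitA {g : AdS3} (hg : g ∈ Omega) :
    rot (Real.arctan (tanAngle (mat g)) + halfTurn g) ∈ orbitA g :=
  mem_orbitA_symm ⟨_, flow_mem_A _ _, act_flow_rot hg⟩

theorem mem_orbitA_of_tanAngle_eq {g h : AdS3} (hg : g ∈ Omega) (hh : h ∈ Omega)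
    (hκ : tanAngle (mat h) = tanAngle (mat g)) (hδ : halfTurn h = halfTurn g) : h ∈ orbitA g := by
  have hrot := rot_mem_orbitA hh
  rw [hκ, hδ] at hrot
  exact mem_orbitA_trans (rot_mem_orbitA hg) (mem_orbitA_symm hrot)

theorem meanCurv_eq_of_mem_orbitA {g h : AdS3} (hg : g ∈ Omega) (hh : h ∈ orbitA g) :
    meanCurv (mat h) = meanCurv (mat g) := by
  obtain ⟨z, hz, rfl⟩ := hh
  obtain ⟨x, y, rfl⟩ := mem_A_iff.1 hz
  exact meanCurv_act_flow x y (mat_mem_regular hg)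

theorem orbitA_subset_Omega {g : AdS3} (hg : g ∈ Omega) : orbitA g ⊆ Omega := by
  rintro _ ⟨z, hz, rfl⟩
  exact act_mem_Omega hg hz

theorem meanCurv_eq_of_rot_mem_orbitA {g : AdS3} (hg : g ∈ Omega) {θ : ℝ}
    (hθ : rot θ ∈ orbitA g) : meanCurv (mat g) = -2 * Real.cot (2 * θ) :=
  (meanCurv_eq_of_mem_orbitA hg hθ).symm.trans (meanCurv_rot (orbitA_subset_Omega hg hθ))

theorem eq_flow_of_act_eq {z : AdS3 × AdS3} (hz : z ∈ A) {g h : AdS3} (hg : g ∈ Omega)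
    (hzg : act z g = h) :
    z = flow (coordX (mat h) - coordX (mat g)) (coordY (mat h) - coordY (mat g)) := by
  obtain ⟨x, y, rfl⟩ := mem_A_iff.1 hz
  have hr := mat_mem_regular hg
  rw [← hzg, coordX_act_flow x y hr, coordY_act_flow x y hr, add_sub_cancel_left,
    add_sub_cancel_left]

theorem existsUnique_rot_mem_orbitA {g : AdS3} (hg : g ∈ Omega) :
    ∃! θ : ℝ, θ ∈ Set.Ico 0 (2 * Real.pi) ∧ rot θ ∈ orbitA g := by
  obtain ⟨θ, hθ, hrot⟩ := rot_periodic.exists_mem_Ico₀ Real.two_pi_pos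
    (Real.arctan (tanAngle (mat g)) + halfTurn g)
  have hθg : rot θ ∈ orbitA g := hrot ▸ rot_mem_orbitA hg
  refine ⟨θ, ⟨hθ, hθg⟩, fun φ ⟨hφ, hφg⟩ => rot_injOn hφ hθ ?_⟩
  obtain ⟨z, hz, hzφ⟩ := mem_orbitA_trans (mem_orbitA_symm hθg) hφg
  have hz1 := eq_flow_of_act_eq hz (orbitA_subset_Omega hg hθg) hzφ
  simp only [coordX_rot, coordY_rot, sub_zero, flow_zero] at hz1
  rw [← hzφ, hz1, act_one]

/-! ### Connected components of `Omega` -/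

theorem continuous_mat_apply (i j : Fin 2) : Continuous fun g : AdS3 => mat g i j :=
  (continuous_apply_apply i j).comp continuous_mat

theorem isOpen_Omega : IsOpen Omega := by
  have hc : Continuous cosSq := (continuous_mat_apply 0 0).mul (continuous_mat_apply 1 1)
  have hs : Continuous sinSq := ((continuous_mat_apply 0 1).mul (continuous_mat_apply 1 0)).neg
  rw [show Omega = {g | 0 < cosSq g} ∩ {g | 0 < sinSq g} from Set.ext fun _ => mem_Omega_iff]
  exact (isOpen_lt continuous_const hc).inter (isOpen_lt continuous_const hs)

/-- The points of `Omega` whose first row has entries of the same signs as the first row of `g₀`;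
this is the connected component of `g₀` in `Omega`. -/
def quadrant (g₀ : AdS3) : Set AdS3 :=
  {g | g ∈ Omega ∧ ∀ j, 0 < mat g 0 j * mat g₀ 0 j}

theorem isOpen_quadrant (g₀ : AdS3) : IsOpen (quadrant g₀) := by
  simp only [quadrant, Set.ofPred_and, Set.ofPred_forall]
  exact isOpen_Omega.inter (isOpen_iInter_of_finite fun j =>
    isOpen_lt continuous_const ((continuous_mat_apply 0 j).mul continuous_const))

theorem mem_quadrant_self {g₀ : AdS3} (hg₀ : g₀ ∈ Omega) : g₀ ∈ quadrant g₀ :=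
  ⟨hg₀, fun j => mul_self_pos.2 (mat_mem_regular hg₀ 0 j)⟩

theorem act_mem_quadrant {z : AdS3 × AdS3} (hz : z ∈ A) {g g₀ : AdS3} (hg : g ∈ quadrant g₀) :
    act z g ∈ quadrant g₀ := by
  refine ⟨act_mem_Omega hg.1 hz, ?_⟩
  obtain ⟨x, y, rfl⟩ := mem_A_iff.1 hz
  simp only [mat_act_flow, Fin.forall_fin_two, Matrix.cons_val_zero, Matrix.cons_val_one, mul_assoc]
  exact ⟨mul_pos (Real.exp_pos _) (hg.2 0), mul_pos (Real.exp_pos _) (hg.2 1)⟩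

theorem mem_quadrant_iff {g g₀ : AdS3} (hg : g ∈ Omega) :
    g ∈ quadrant g₀ ↔
      0 < mat g 0 0 * mat g₀ 0 0 ∧ 0 < tanAngle (mat g) * tanAngle (mat g₀) := by
  have hκ : tanAngle (mat g) * tanAngle (mat g₀) =
      mat g 0 1 * mat g₀ 0 1 / (mat g 0 0 * mat g₀ 0 0) *
        (Real.exp (coordX (mat g) - coordY (mat g)) *
          Real.exp (coordX (mat g₀) - coordY (mat g₀))) := by
    rw [tanAngle, tanAngle]
    ring
  have : g ∈ quadrant g₀ ↔ 0 < mat g 0 0 * mat g₀ 0 0 ∧ 0 < mat g 0 1 * mat g₀ 0 1 := by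
    simp [quadrant, hg, Fin.forall_fin_two]
  rw [this, hκ, mul_pos_iff_of_pos_right (mul_pos (Real.exp_pos _) (Real.exp_pos _))]
  exact and_congr_right fun h => (div_pos_iff_of_pos_right h).symm

theorem halfTurn_eq_of_mem_quadrant {g g₀ : AdS3} (hg : g ∈ quadrant g₀) :
    halfTurn g = halfTurn g₀ := by
  have := hg.2 0
  simp only [halfTurn, pos_iff_pos_of_mul_pos this]

theorem cos_mul_pos {g : AdS3} (hg : g ∈ Omega) (κ : ℝ) :
    0 < Real.cos (Real.arctan κ + halfTurn g) * mat g 0 0 := by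
  have := Real.cos_arctan_pos κ
  have h00 := mat_mem_regular hg 0 0
  unfold halfTurn
  split_ifs with h
  · rw [add_zero]
    positivity
  · rw [Real.cos_add_pi]
    exact mul_pos_of_neg_of_neg (by linarith) (lt_of_le_of_ne (not_lt.1 h) h00)

theorem act_flow_rot_mem_quadrant {g₀ : AdS3} (hg₀ : g₀ ∈ Omega) {κ : ℝ}
    (hκ : 0 < κ * tanAngle (mat g₀)) (x y : ℝ) :
    act (flow x y) (rot (Real.arctan κ + halfTurn g₀)) ∈ quadrant g₀ := by
  have hrot : rot (Real.arctan κ + halfTurn g₀) ∈ Omega := by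
    rw [rot_mem_Omega_iff, tan_arctan_add_halfTurn]
    exact left_ne_zero_of_mul hκ.ne'
  refine act_mem_quadrant (flow_mem_A x y) ((mem_quadrant_iff hrot).2 ⟨cos_mul_pos hg₀ κ, ?_⟩)
  rwa [tanAngle_rot, tan_arctan_add_halfTurn]

theorem tanAngle_mul_pos {g g₀ : AdS3} (hg : g ∈ quadrant g₀) :
    0 < tanAngle (mat g) * tanAngle (mat g₀) := ((mem_quadrant_iff hg.1).1 hg).2

theorem quadrant_eq_image {g₀ : AdS3} (hg₀ : g₀ ∈ Omega) :
    quadrant g₀ = (fun p : ℝ × ℝ × ℝ =>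
      act (flow p.2.1 p.2.2) (rot (Real.arctan p.1 + halfTurn g₀))) ''
        ({κ | 0 < κ * tanAngle (mat g₀)} ×ˢ Set.univ) := by
  ext g
  constructor
  · intro hg
    refine ⟨(tanAngle (mat g), coordX (mat g), coordY (mat g)), ⟨tanAngle_mul_pos hg, trivial⟩, ?_⟩
    rw [← halfTurn_eq_of_mem_quadrant hg]
    exact act_flow_rot hg.1
  · rintro ⟨⟨κ, x, y⟩, ⟨hκ, -⟩, rfl⟩
    exact act_flow_rot_mem_quadrant hg₀ hκ x y

theorem isPreconnected_quadrant {g₀ : AdS3} (hg₀ : g₀ ∈ Omega) : IsPreconnected (quadrant g₀) := by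
  have hconv : Convex ℝ {κ : ℝ | 0 < κ * tanAngle (mat g₀)} :=
    (convex_Ioi 0).is_linear_preimage (IsLinearMap.isLinearMap_smul' (tanAngle (mat g₀)))
  rw [quadrant_eq_image hg₀]
  exact (hconv.isPreconnected.prod isPreconnected_univ).image _ (continuous_act
    (continuous_flow (by fun_prop) (by fun_prop)) (continuous_rot.comp (by fun_prop))).continuousOn

theorem mul_pos_of_isPreconnected {Z : Type*} [TopologicalSpace Z] {S : Set Z}
    (hS : IsPreconnected S) {f : Z → ℝ} (hf : ContinuousOn f S) (hf0 : ∀ z ∈ S, f z ≠ 0) {x y : Z}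
    (hx : x ∈ S) (hy : y ∈ S) : 0 < f x * f y := by
  have ho := (hS.image f hf).ordConnected
  have h0 : (0 : ℝ) ∉ f '' S := fun ⟨z, hz, h⟩ => hf0 z hz h
  have hx' := Set.mem_image_of_mem f hx
  have hy' := Set.mem_image_of_mem f hy
  by_contra! hle
  rcases mul_nonpos_iff.1 hle with ⟨h₁, h₂⟩ | ⟨h₁, h₂⟩
  exacts [h0 (ho.out hy' hx' ⟨h₂, h₁⟩), h0 (ho.out hx' hy' ⟨h₁, h₂⟩)]

theorem connectedComponentIn_Omega_eq {g₀ : AdS3} (hg₀ : g₀ ∈ Omega) :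
    connectedComponentIn Omega g₀ = quadrant g₀ := by
  refine Set.Subset.antisymm (fun g hg => ?_)
    ((isPreconnected_quadrant hg₀).subset_connectedComponentIn (mem_quadrant_self hg₀)
      fun g hg => hg.1)
  exact ⟨connectedComponentIn_subset _ _ hg, fun j => mul_pos_of_isPreconnected
    isPreconnected_connectedComponentIn (continuous_mat_apply 0 j).continuousOn
    (fun h hh => mat_mem_regular (connectedComponentIn_subset _ _ hh) 0 j) hg
    (mem_connectedComponentIn hg₀)⟩

theorem mem_orbitA_iff_meanCurv_eq {g h g₀ : AdS3} (hg : g ∈ quadrant g₀) (hh : h ∈ quadrant g₀) :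
    h ∈ orbitA g ↔ meanCurv (mat h) = meanCurv (mat g) := by
  refine ⟨meanCurv_eq_of_mem_orbitA hg.1, fun hτ => mem_orbitA_of_tanAngle_eq hg.1 hh.1 ?_ ?_⟩
  · have hg' := tanAngle_ne_zero (mat_mem_regular hg.1)
    have hh' := tanAngle_ne_zero (mat_mem_regular hh.1)
    have hpos : 0 < tanAngle (mat h) * tanAngle (mat g) := by
      have := mul_pos (tanAngle_mul_pos hh) (tanAngle_mul_pos hg)
      nlinarith [sq_nonneg (tanAngle (mat g₀))]
    have hfactor : (tanAngle (mat h) - tanAngle (mat g)) *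
        (tanAngle (mat h) * tanAngle (mat g) + 1) = 0 := by
      rw [meanCurv, meanCurv] at hτ
      field_simp at hτ
      linear_combination hτ
    exact sub_eq_zero.1 ((mul_eq_zero.1 hfactor).resolve_right (by positivity))
  · rw [halfTurn_eq_of_mem_quadrant hh, halfTurn_eq_of_mem_quadrant hg]

/-- Open subsets of `Omega` invariant under `A`: the setting in which the quotients by discrete
subgroups of `A` are spacetimes foliated by level surfaces of constant mean curvature. -/
structure IsOpenInvariant (U : Set AdS3) : Prop where
  isOpen : IsOpen U
  subset_Omega : U ⊆ Omega
  act_mem : ∀ z ∈ A, ∀ g ∈ U, act z g ∈ U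

theorem isOpenInvariant_quadrant (g₀ : AdS3) : IsOpenInvariant (quadrant g₀) where
  isOpen := isOpen_quadrant g₀
  subset_Omega := fun _ hg => hg.1
  act_mem := fun _ hz _ hg => act_mem_quadrant hz hg

theorem IsOpenInvariant.act_image {U : Set AdS3} (hU : IsOpenInvariant U) {z : AdS3 × AdS3}
    (hz : z ∈ A) : act z '' U = U :=
  Set.Subset.antisymm (Set.image_subset_iff.2 (hU.act_mem z hz)) fun g hg =>
    ⟨act z⁻¹ g, hU.act_mem _ (A.inv_mem hz) g hg, by simpa using! act_inv_act z⁻¹ g⟩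

/-! ### The quotient by a discrete subgroup of `A` -/

section Quotient

variable {Γ : Subgroup (AdS3 × AdS3)} {U : Set AdS3}

/-- The element of `A` that `u` and `v` determine if they are in the same orbit. -/
def shift (u v : AdS3) : AdS3 × AdS3 :=
  flow (coordX (mat v) - coordX (mat u)) (coordY (mat v) - coordY (mat u))

theorem continuous_comp_mat (hU : IsOpenInvariant U) {f : Mat → ℝ}
    (hf : ContDiffOn ℝ ∞ f regular) : Continuous fun u : U => f (mat u) :=
  hf.continuousOn.comp_continuous (continuous_mat.comp continuous_subtype_val) fun u =>
    mat_mem_regular (hU.subset_Omega u.2)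

theorem continuous_shift (hU : IsOpenInvariant U) :
    Continuous fun p : U × U => shift p.1 p.2 := by
  have hX := continuous_comp_mat hU contDiffOn_coordX
  have hY := continuous_comp_mat hU contDiffOn_coordY
  exact continuous_flow ((hX.comp continuous_snd).sub (hX.comp continuous_fst))
    ((hY.comp continuous_snd).sub (hY.comp continuous_fst))

theorem act_shift_iff (hU : IsOpenInvariant U) (hΓ : Γ ≤ A) {u v : U} :
    (∃ z ∈ Γ, act z u = v) ↔ shift u v ∈ Γ ∧ act (shift u v) u = v := by
  refine ⟨?_, fun h => ⟨_, h⟩⟩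
  rintro ⟨z, hz, h⟩
  obtain rfl : z = shift u v := eq_flow_of_act_eq (hΓ hz) (hU.subset_Omega u.2) h
  exact ⟨hz, h⟩

theorem proj_eq_iff {u v : U} : proj Γ U u = proj Γ U v ↔ ∃ z ∈ Γ, act z u = v := by
  unfold proj
  rw [Quotient.eq]
  rfl

/-- The action on an invariant set of a subgroup of `A`. -/
@[reducible] def invariantAction (hU : IsOpenInvariant U) (hΓ : Γ ≤ A) : MulAction Γ U where
  smul z u := ⟨act z.1 u.1, hU.act_mem z.1 (hΓ z.2) u.1 u.2⟩
  one_smul u := Subtype.ext (act_one u.1)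
  mul_smul z w u := Subtype.ext (act_mul z.1 w.1 u.1)

theorem exists_nhds_eq_one_of_act_mem [DiscreteTopology Γ] (hU : IsOpenInvariant U) (hΓ : Γ ≤ A)
    (u : U) : ∃ N ∈ 𝓝 u, ∀ z ∈ Γ, ∀ v ∈ N, ∀ w ∈ N, act z v = w → z = 1 := by
  have hdiscrete : ∀ᶠ z in 𝓝 (shift u u), z ∈ Γ → z = 1 := by
    obtain ⟨V, hV, hVΓ⟩ := (discreteTopology_subtype_iff'.1 ‹DiscreteTopology Γ›) 1 Γ.one_mem
    have h1 : (1 : AdS3 × AdS3) ∈ V := (hVΓ.ge rfl).1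
    rw [shift, sub_self, sub_self, flow_zero]
    filter_upwards [hV.mem_nhds h1] with z hzV hzΓ using hVΓ.le ⟨hzV, hzΓ⟩
  have hev := ((continuous_shift hU).tendsto (u, u)).eventually hdiscrete
  rw [nhds_prod_eq, Filter.eventually_prod_self_iff'] at hev
  obtain ⟨N, hN, hNΓ⟩ := hev
  refine ⟨N, hN, fun z hz v hv w hw h => ?_⟩
  obtain rfl : z = shift v w := eq_flow_of_act_eq (hΓ hz) (hU.subset_Omega v.2) h
  exact hNΓ v hv w hw hz

theorem isQuotientCoveringMap_proj [DiscreteTopology Γ] (hU : IsOpenInvariant U) (hΓ : Γ ≤ A) :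
    letI := invariantAction hU hΓ
    IsQuotientCoveringMap (proj Γ U) Γ := by
  let := invariantAction hU hΓ
  have hquot : IsQuotientMap (proj Γ U) := isQuotientMap_quot_mk
  refine { hquot with
    continuous_const_smul := fun z =>
      (continuous_act continuous_const continuous_subtype_val).subtype_mk _
    apply_eq_iff_mem_orbit := ?_
    disjoint := ?_ }
  · intro u v
    rw [eq_comm, proj_eq_iff]
    constructor
    · rintro ⟨z, hz, h⟩
      exact ⟨⟨z, hz⟩, Subtype.ext h⟩
    · rintro ⟨z, h⟩
      exact ⟨z.1, z.2, congrArg Subtype.val h⟩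
  · intro u
    obtain ⟨N, hN, hNΓ⟩ := exists_nhds_eq_one_of_act_mem hU hΓ u
    refine ⟨N, hN, ?_⟩
    rintro z ⟨_, ⟨v, hv, rfl⟩, hw⟩
    exact Subtype.ext (hNΓ z.1 z.2 v hv _ hw rfl)

theorem isClosed_setOf_proj_eq [DiscreteTopology Γ] (hU : IsOpenInvariant U) (hΓ : Γ ≤ A) :
    IsClosed {p : U × U | proj Γ U p.1 = proj Γ U p.2} := by
  have hclosed : IsClosed (Γ : Set (AdS3 × AdS3)) := Subgroup.isClosed_of_discrete
  have hshift := continuous_shift hU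
  simp only [proj_eq_iff, act_shift_iff hU hΓ]
  exact (hclosed.preimage hshift).inter (isClosed_eq
    (continuous_act hshift (continuous_subtype_val.comp continuous_fst))
    (continuous_subtype_val.comp continuous_snd))

variable {e : OpenPartialHomeomorph (TorusUniverse Γ U) AdS3}

theorem exists_proj_chart_eq (he : e ∈ torusCharts Γ U) {x : TorusUniverse Γ U}
    (hx : x ∈ e.source) : ∃ h : e x ∈ U, proj Γ U ⟨e x, h⟩ = x := by
  obtain ⟨u, hu, hex⟩ := he x hx
  simpa only [hex] using ⟨u.2, hu⟩

theorem IsOpenInvariant.mem_Omega_chart (hU : IsOpenInvariant U) (he : e ∈ torusCharts Γ U)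
    {x : TorusUniverse Γ U} (hx : x ∈ e.source) : e x ∈ Omega :=
  hU.subset_Omega (exists_proj_chart_eq he hx).1

theorem symm_chart_eq_proj (he : e ∈ torusCharts Γ U) {u : U} (hu : u.1 ∈ e.target) :
    e.symm u = proj Γ U u := by
  obtain ⟨h, hproj⟩ := exists_proj_chart_eq he (e.map_target hu)
  simpa only [e.right_inv hu] using hproj.symm

/-- Through the inverse of the chart, which is the projection, any two local lifts of the same map
agree up to the element of `Γ` that relates them at one point. -/
theorem exists_eventually_act_eq_chart (hU : IsOpenInvariant U) (hΓ : Γ ≤ A)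
    (he : e ∈ torusCharts Γ U) {Z : Type*} [TopologicalSpace Z] {p : Z → TorusUniverse Γ U}
    {f : Z → AdS3} {a : Z} (ha : p a ∈ e.source) (hf : ContinuousAt f a)
    (hfp : ∀ᶠ y in 𝓝 a, ∃ h : f y ∈ U, proj Γ U ⟨f y, h⟩ = p y) :
    ∃ z ∈ Γ, ∀ᶠ y in 𝓝 a, act z (f y) = e (p y) := by
  obtain ⟨hfa, hpa⟩ := hfp.self_of_nhds
  obtain ⟨hea, hepa⟩ := exists_proj_chart_eq he ha
  obtain ⟨z, hz, hzfa⟩ := proj_eq_iff.1 (hpa.trans hepa.symm)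
  have htarget : ∀ᶠ y in 𝓝 a, act z (f y) ∈ e.target := by
    have hact : ContinuousAt (fun y => act z (f y)) a :=
      (continuous_act continuous_const continuous_id).continuousAt.comp hf
    exact hact.eventually_mem (e.open_target.mem_nhds (hzfa ▸ e.map_source ha))
  refine ⟨z, hz, ?_⟩
  filter_upwards [htarget, hfp] with y hy ⟨hfy, hpy⟩
  have hproj : proj Γ U ⟨act z (f y), hU.act_mem z (hΓ hz) _ hfy⟩ = p y :=
    (proj_eq_iff.2 ⟨z, hz, rfl⟩).symm.trans hpy
  rw [← hproj, ← symm_chart_eq_proj he hy, e.right_inv hy]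

theorem exists_chart [DiscreteTopology Γ] (hU : IsOpenInvariant U) (hΓ : Γ ≤ A)
    (x : TorusUniverse Γ U) : ∃ e ∈ torusCharts Γ U, x ∈ e.source := by
  let := invariantAction hU hΓ
  obtain ⟨u, rfl⟩ := Quotient.exists_rep x
  obtain ⟨f, hu, hf⟩ := (isQuotientCoveringMap_proj hU hΓ).isCoveringMap.isLocalHomeomorph u
  have : Nonempty U := ⟨u⟩
  refine ⟨f.symm.trans (hU.isOpen.isOpenEmbedding_subtypeVal.toOpenPartialHomeomorph _),
    fun x hx => ⟨f.symm x, ?_, rfl⟩, ?_⟩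
  · rw [hf, f.right_inv (by simpa using hx)]
  · have : f u ∈ f.target := f.map_source hu
    rw [← hf] at this
    simpa using! this

theorem isSpacetime_torusCharts [DiscreteTopology Γ] (hU : IsOpenInvariant U) (hΓ : Γ ≤ A)
    (hUc : IsConnected U) : IsSpacetime (torusCharts Γ U) := by
  let := invariantAction hU hΓ
  have ho := (isQuotientCoveringMap_proj hU hΓ).isOpenQuotientMap
  refine ⟨(t2Space_iff_of_isOpenQuotientMap ho).2 (isClosed_setOf_proj_eq hU hΓ), ?_, ?_,
    exists_chart hU hΓ, ?_⟩
  · have : SecondCountableTopology AdS3 :=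
      inferInstanceAs (SecondCountableTopology {A : Fin 2 → Fin 2 → ℝ // (Matrix.of A).det = 1})
    exact ho.isQuotientMap.secondCountableTopology ho.isOpenMap
  · have := Subtype.connectedSpace hUc
    exact inferInstanceAs (ConnectedSpace (Quotient (orbitSetoid Γ U)))
  · rintro e he e' he' x ⟨hx, hx'⟩
    obtain ⟨z, -, h⟩ := exists_eventually_act_eq_chart (p := id) hU hΓ he' hx' (e.continuousAt hx)
      ((e.open_source.eventually_mem hx).mono fun y hy => exists_proj_chart_eq he hy)
    exact ⟨z.1, z.2, h.mono fun y hy => hy.symm⟩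

/-- The mean curvature of the orbits, as a function on the quotient. -/
def quotientMeanCurv (hU : IsOpenInvariant U) (hΓ : Γ ≤ A) : TorusUniverse Γ U → ℝ :=
  Quotient.lift (fun u => meanCurv (mat u)) fun u _ ⟨z, hz, h⟩ =>
    (meanCurv_eq_of_mem_orbitA (hU.subset_Omega u.2) ⟨z, hΓ hz, h⟩).symm

theorem quotientMeanCurv_proj (hU : IsOpenInvariant U) (hΓ : Γ ≤ A) (u : U) :
    quotientMeanCurv hU hΓ (proj Γ U u) = meanCurv (mat u) := rfl

theorem continuous_quotientMeanCurv (hU : IsOpenInvariant U) (hΓ : Γ ≤ A) :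
    Continuous (quotientMeanCurv hU hΓ) :=
  (continuous_comp_mat hU contDiffOn_meanCurv).quotient_lift _

theorem quotientMeanCurv_eq_chart (hU : IsOpenInvariant U) (hΓ : Γ ≤ A)
    (he : e ∈ torusCharts Γ U) {x : TorusUniverse Γ U} (hx : x ∈ e.source) :
    quotientMeanCurv hU hΓ x = meanCurv (mat (e x)) := by
  obtain ⟨h, hproj⟩ := exists_proj_chart_eq he hx
  exact congrArg (quotientMeanCurv hU hΓ) hproj.symm

end Quotient

/-! ### The level surfaces of the mean curvature -/

theorem isTangent_of_hasDerivAt {c : ℝ → AdS3} {t : ℝ} {X : Mat}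
    (hc : HasDerivAt (fun s => mat (c s)) X t) : IsTangent (c t) X := by
  have hentry (i j) := hasDerivAt_pi.1 (hasDerivAt_pi.1 hc i) j
  have hdet := ((hentry 0 0).mul (hentry 1 1)).sub ((hentry 0 1).mul (hentry 1 0))
  have hconst : HasDerivAt (fun s => mat (c s) 0 0 * mat (c s) 1 1 - mat (c s) 0 1 * mat (c s) 1 0)
      0 t := by
    simp only [mat_det]
    exact hasDerivAt_const t 1
  have := hdet.unique hconst
  rw [IsTangent, B_eq]
  linarith

theorem B_frame_one_of_isTangentTo {S : Set AdS3} {g : AdS3} {k : ℝ} {X : Mat} (hg : g ∈ Omega)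
    (hS : ∀ h ∈ S, meanCurv (mat h) = k) (hX : IsTangentTo S g X) :
    B (frame (mat g) 1 0 0) X = 0 := by
  obtain ⟨c, rfl, hcS, hc⟩ := hX
  obtain ⟨ζ, ξ, η, rfl⟩ := (isTangent_iff_exists_frame hg).1 (isTangent_of_hasDerivAt hc)
  have hmean := hasDerivAt_meanCurv (mat_mem_regular hg) hc
  have hconst : HasDerivAt (fun t => meanCurv (mat (c t))) 0 0 :=
    (hasDerivAt_const 0 k).congr_of_eventuallyEq (hcS.mono fun t ht => hS _ ht)
  have hζ : ζ = 0 := (mul_eq_zero.1 (hmean.unique hconst)).resolve_left (by positivity)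
  simp [B_frame hg, hζ]

theorem isFutureTimelike_frame_one {g : AdS3} (hg : g ∈ Omega) :
    IsFutureTimelike g (frame (mat g) 1 0 0) := by
  refine ⟨isTangent_frame hg 1 0 0, by simp [Q_frame hg], ?_⟩
  rw [timeField_eq_frame hg rfl, B_frame hg]
  linarith [Real.cosh_pos (coordY (mat g) - coordX (mat g))]

theorem contDiffOn_frame (ζ ξ η : ℝ) : ContDiffOn ℝ ∞ (fun m => frame m ζ ξ η) regular := by
  have hκ := contDiffOn_tanAngle
  refine contDiffOn_pi.2 fun i => contDiffOn_pi.2 fun j => ?_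
  fin_cases i <;> fin_cases j <;>
    exact ContDiffOn.mul (by fun_prop)
      (by fun_prop (disch := exact fun _ => tanAngle_ne_zero))

/-- Along the orbits `tan θ` is constant, so that the unit normal restricts to a linear field. -/
theorem fderiv_frame_one {g : AdS3} (hg : g ∈ Omega) (ξ η : ℝ) :
    fderiv ℝ (fun m => frame m 1 0 0) (mat g) (frame (mat g) 0 ξ η) =
      frame (mat g) 0 (-(tanAngle (mat g) * ξ)) ((tanAngle (mat g))⁻¹ * η) := by
  have hr := mat_mem_regular hg
  have hcurve := hasDerivAt_act_flow g ξ η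
  have hdiff : DifferentiableAt ℝ (fun m => frame m 1 0 0) (mat g) :=
    ((contDiffOn_frame 1 0 0).contDiffAt (isOpen_regular.mem_nhds hr)).differentiableAt (by simp)
  have hcomp := HasFDerivAt.comp_hasDerivAt_of_eq 0 hdiff.hasFDerivAt hcurve
    (by simp [flow_zero, act_one])
  refine hcomp.unique ?_
  have hentry (i j) := hasDerivAt_pi.1 (hasDerivAt_pi.1 hcurve i) j
  simp only [Function.comp_def, frame, tanAngle_act_flow _ _ hr]
  refine hasDerivAt_pi.2 fun i => hasDerivAt_pi.2 fun j => ?_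
  fin_cases i <;> fin_cases j
  · exact ((hentry 0 0).mul_const _).congr_deriv (by simp [frame]; ring)
  · exact ((hentry 0 1).mul_const _).congr_deriv (by simp [frame]; ring)
  · exact ((hentry 1 0).mul_const _).congr_deriv (by simp [frame]; ring)
  · exact ((hentry 1 1).mul_const _).congr_deriv (by simp [frame]; ring)

theorem covDeriv_frame_one {g : AdS3} (hg : g ∈ Omega) (ξ η : ℝ) :
    covDeriv g (fun m => frame m 1 0 0) (frame (mat g) 0 ξ η) =
      frame (mat g) 0 (-(tanAngle (mat g) * ξ)) ((tanAngle (mat g))⁻¹ * η) := by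
  have htangent := isTangent_frame hg 0 (-(tanAngle (mat g) * ξ)) ((tanAngle (mat g))⁻¹ * η)
  rw [covDeriv, fderiv_frame_one hg, tangentProj, htangent, zero_smul, add_zero]

section Levels

variable {Γ : Subgroup (AdS3 × AdS3)} {U : Set AdS3}
  (hU : IsOpenInvariant U) (hΓ : Γ ≤ A)
include hU hΓ

theorem isTangentTo_level {e : OpenPartialHomeomorph (TorusUniverse Γ U) AdS3}
    (he : e ∈ torusCharts Γ U) {p : TorusUniverse Γ U} (hp : p ∈ e.source) {k : ℝ}
    (hk : quotientMeanCurv hU hΓ p = k) (ξ η : ℝ) :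
    IsTangentTo (e '' (e.source ∩ quotientMeanCurv hU hΓ ⁻¹' {k})) (e p)
      (frame (mat (e p)) 0 ξ η) := by
  have hcont : Continuous fun t : ℝ => act (flow (ξ * t) (η * t)) (e p) :=
    continuous_act (continuous_flow (by fun_prop) (by fun_prop)) continuous_const
  have h0 : act (flow (ξ * 0) (η * 0)) (e p) = e p := by simp [flow_zero, act_one]
  refine ⟨_, h0, ?_, hasDerivAt_act_flow (e p) ξ η⟩
  have htarget := hcont.continuousAt.eventually_mem
    (e.open_target.mem_nhds (h0.symm ▸ e.map_source hp))
  filter_upwards [htarget] with t ht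
  refine ⟨_, ⟨e.map_target ht, ?_⟩, e.right_inv ht⟩
  rw [Set.mem_preimage, Set.mem_singleton_iff, ← hk,
    quotientMeanCurv_eq_chart hU hΓ he (e.map_target ht), e.right_inv ht,
    meanCurv_act_flow _ _ (mat_mem_regular (hU.mem_Omega_chart he hp)),
    quotientMeanCurv_eq_chart hU hΓ he hp]

variable [DiscreteTopology Γ]

theorem isSpacelikeSurface_level (k : ℝ) :
    IsSpacelikeSurface (torusCharts Γ U) (quotientMeanCurv hU hΓ ⁻¹' {k}) := by
  intro p _
  obtain ⟨e, he, hp⟩ := exists_chart hU hΓ p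
  refine ⟨e, he, hp, regular, fun m => meanCurv m - k, isOpen_regular,
    mat_mem_regular (hU.mem_Omega_chart he hp), contDiffOn_meanCurv.sub contDiffOn_const,
    fun q hq hr => ⟨?_, fun _ X hX hX0 hfX => ?_⟩⟩
  · rw [Set.mem_preimage, Set.mem_singleton_iff, quotientMeanCurv_eq_chart hU hΓ he hq, sub_eq_zero]
  · have hg := hU.mem_Omega_chart he hq
    obtain ⟨ζ, ξ, η, rfl⟩ := (isTangent_iff_exists_frame hg).1 hX
    rw [fderiv_sub_const, fderiv_meanCurv_frame hr] at hfX
    obtain rfl : ζ = 0 := (mul_eq_zero.1 hfX).resolve_left (by positivity)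
    have hne : ξ ≠ 0 ∨ η ≠ 0 := by
      by_contra! h
      refine hX0 (mat_ext ?_ ?_ ?_ ?_) <;> simp [frame, h.1, h.2]
    obtain ⟨hc, hs⟩ := mem_Omega_iff.1 hg
    rw [Q_frame_zero]
    rcases hne with h | h <;> positivity

theorem hasMeanCurvatureAt_level {k : ℝ} {p : TorusUniverse Γ U}
    (hk : quotientMeanCurv hU hΓ p = k) :
    HasMeanCurvatureAt (torusCharts Γ U) (quotientMeanCurv hU hΓ ⁻¹' {k}) p k := by
  obtain ⟨e, he, hp⟩ := exists_chart hU hΓ p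
  have hg := hU.mem_Omega_chart he hp
  obtain ⟨hc, hs⟩ := mem_Omega_iff.1 hg
  have hnorm {r : ℝ} (hr : 0 < r) : r * ((√r)⁻¹ * (√r)⁻¹) = 1 := by
    rw [← mul_inv, Real.mul_self_sqrt hr.le, mul_inv_cancel₀ hr.ne']
  have hx := hnorm hc
  have hy := hnorm hs
  refine ⟨e, he, hp, regular, fun m => frame m 1 0 0, isOpen_regular, mat_mem_regular hg,
    contDiffOn_frame 1 0 0, fun q hq _ _ => ?_, _, _,
    isTangentTo_level hU hΓ he hp hk (√(cosSq (e p)))⁻¹ 0,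
    isTangentTo_level hU hΓ he hp hk 0 (√(sinSq (e p)))⁻¹, ?_, ?_, ?_, ?_⟩
  · have hgq := hU.mem_Omega_chart he hq
    refine ⟨isFutureTimelike_frame_one hgq, by simp [Q_frame hgq], fun X hX =>
      B_frame_one_of_isTangentTo (k := k) hgq ?_ hX⟩
    rintro _ ⟨q', ⟨hq', hqk'⟩, rfl⟩
    exact (quotientMeanCurv_eq_chart hU hΓ he hq').symm.trans hqk'
  · rw [Q_eq_B, B_frame hg]
    linear_combination hx
  · rw [Q_eq_B, B_frame hg]
    linear_combination hy
  · simp [B_frame hg]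
  · rw [covDeriv_frame_one hg, covDeriv_frame_one hg, B_frame hg, B_frame hg, ← hk,
      quotientMeanCurv_eq_chart hU hΓ he hp, meanCurv]
    linear_combination (tanAngle (mat (e p)))⁻¹ * hy - tanAngle (mat (e p)) * hx

theorem isCMCSurface_level (k : ℝ) :
    IsCMCSurface (torusCharts Γ U) (quotientMeanCurv hU hΓ ⁻¹' {k}) k :=
  ⟨isSpacelikeSurface_level hU hΓ k, fun _ => hasMeanCurvatureAt_level hU hΓ⟩

theorem isSubmersion_quotientMeanCurv :
    IsSubmersion (torusCharts Γ U) (quotientMeanCurv hU hΓ) := by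
  intro p
  obtain ⟨e, he, hp⟩ := exists_chart hU hΓ p
  have hg := hU.mem_Omega_chart he hp
  refine ⟨e, he, hp, regular, meanCurv, isOpen_regular, mat_mem_regular hg, contDiffOn_meanCurv,
    fun q hq _ => quotientMeanCurv_eq_chart hU hΓ he hq, _, isTangent_frame hg 1 0 0, ?_⟩
  rw [fderiv_meanCurv_frame (mat_mem_regular hg)]
  positivity

end Levels

/-! ### Causal curves -/

theorem lt_of_deriv_pos_off_finite {f : ℝ → ℝ} {S : Set ℝ} (hS : S.Finite) {a b : ℝ} (hab : a < b)
    (hf : ContinuousOn f (Set.Icc a b)) (hpos : ∀ t ∈ Set.Ioo a b, t ∉ S → 0 < deriv f t) :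
    f a < f b := by
  induction S, hS using Set.Finite.induction_on generalizing a b with
  | empty =>
    exact strictMonoOn_of_deriv_pos (convex_Icc a b) hf (by simpa [interior_Icc] using hpos)
      (Set.left_mem_Icc.2 hab.le) (Set.right_mem_Icc.2 hab.le) hab
  | @insert s S _ _ ih =>
    by_cases hs : s ∈ Set.Ioo a b
    · refine (ih hs.1 (hf.mono (Set.Icc_subset_Icc_right hs.2.le)) fun t ht htS => ?_).trans
        (ih hs.2 (hf.mono (Set.Icc_subset_Icc_left hs.1.le)) fun t ht htS => ?_)
      · exact hpos t ⟨ht.1, ht.2.trans hs.2⟩ (by simp [ht.2.ne, htS])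
      · exact hpos t ⟨hs.1.trans ht.1, ht.2⟩ (by simp [ht.1.ne', htS])
    · refine ih hab hf fun t ht htS => hpos t ht ?_
      rw [Set.mem_insert_iff, not_or]
      exact ⟨fun h => hs (h ▸ ht), htS⟩

theorem strictMono_of_deriv_pos_off_locallyFinite {f : ℝ → ℝ} (hf : Continuous f) {S : Set ℝ}
    (hS : ∀ a b, (S ∩ Set.Icc a b).Finite) (hpos : ∀ t ∉ S, 0 < deriv f t) : StrictMono f :=
  fun a b hab => lt_of_deriv_pos_off_finite (hS a b) hab hf.continuousOn fun t ht htS =>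
    hpos t fun h => htS ⟨h, Set.Ioo_subset_Icc_self ht⟩

theorem exists_tendsto_atTop_of_sum_bddAbove {ι : Type*} [Fintype ι] {f : ι → ℝ → ℝ}
    (hf : ∀ i, Monotone (f i)) (hb : BddAbove (Set.range fun t => ∑ i, f i t)) (i : ι) :
    ∃ L, Filter.Tendsto (f i) Filter.atTop (𝓝 L) := by
  classical
  refine (tendsto_atTop_of_monotone (hf i)).resolve_left fun hi => ?_
  have hrest : Monotone fun t => ∑ j ∈ Finset.univ.erase i, f j t := fun a b hab =>
    Finset.sum_le_sum fun j _ => hf j hab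
  refine Filter.not_bddAbove_of_tendsto_atTop (Filter.tendsto_atTop_add_right_of_le' _
    (∑ j ∈ Finset.univ.erase i, f j 0) hi ((Filter.eventually_ge_atTop 0).mono fun t ht =>
      hrest ht)) ?_
  simpa only [fun t => Finset.add_sum_erase _ (fun j => f j t) (Finset.mem_univ i)] using hb

theorem exists_tendsto_atBot_of_sum_bddBelow {ι : Type*} [Fintype ι] {f : ι → ℝ → ℝ}
    (hf : ∀ i, Monotone (f i)) (hb : BddBelow (Set.range fun t => ∑ i, f i t)) (i : ι) :
    ∃ L, Filter.Tendsto (f i) Filter.atBot (𝓝 L) := by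
  have hmono (j) : Monotone fun t => -f j (-t) := fun a b hab => neg_le_neg (hf j (neg_le_neg hab))
  obtain ⟨M, hM⟩ := hb
  obtain ⟨L, hL⟩ := exists_tendsto_atTop_of_sum_bddAbove hmono ⟨-M, by
    rintro _ ⟨t, rfl⟩
    simpa using hM ⟨-t, rfl⟩⟩ i
  exact ⟨-L, by simpa [Function.comp_def] using hL.neg.comp Filter.tendsto_neg_atBot_atTop⟩

section Curves

variable {Γ : Subgroup (AdS3 × AdS3)} {U : Set AdS3}
  (hU : IsOpenInvariant U) (hΓ : Γ ≤ A)
include hU hΓ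

theorem quotientMeanCurv_lt {γ : ℝ → TorusUniverse Γ U} {I : Set ℝ}
    (hγ : IsCurveOn (torusCharts Γ U) IsFutureNonspacelike γ I) {a b : ℝ} (hab : a < b)
    (hI : Set.Icc a b ⊆ I) :
    quotientMeanCurv hU hΓ (γ a) < quotientMeanCurv hU hΓ (γ b) := by
  obtain ⟨hcont, S, hS, hvel⟩ := hγ
  refine lt_of_deriv_pos_off_finite (f := fun t => quotientMeanCurv hU hΓ (γ t)) (hS a b) hab
    ((continuous_quotientMeanCurv hU hΓ).comp_continuousOn (hcont.mono hI)) fun t ht htS => ?_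
  have htI : t ∈ interior I := interior_maximal (Set.Ioo_subset_Icc_self.trans hI) isOpen_Ioo ht
  obtain ⟨e, he, hte, X, hX, hcausal⟩ :=
    hvel t htI fun h => htS ⟨h, Set.Ioo_subset_Icc_self ht⟩
  have hchart : (fun s => quotientMeanCurv hU hΓ (γ s)) =ᶠ[𝓝 t]
      fun s => (∑ i, causalCoord (mat (e (γ s))) i) / 2 := by
    have hsource := (hcont.continuousAt (mem_interior_iff_mem_nhds.1 htI)).eventually_mem
      (e.open_source.mem_nhds hte)
    filter_upwards [hsource] with s hs
    rw [quotientMeanCurv_eq_chart hU hΓ he hs, sum_causalCoord]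
    ring
  choose r hr hderiv using
    exists_hasDerivAt_causalCoord (hU.mem_Omega_chart he hte) rfl hcausal hX
  rw [hchart.deriv_eq, ((HasDerivAt.fun_sum fun i _ => hderiv i).div_const 2).deriv]
  exact half_pos (Finset.sum_pos (fun i _ => hr i) Finset.univ_nonempty)

variable [DiscreteTopology Γ]

theorem isCMCTimeFunction_quotientMeanCurv :
    IsCMCTimeFunction (torusCharts Γ U) (quotientMeanCurv hU hΓ) := by
  refine ⟨⟨isSubmersion_quotientMeanCurv hU hΓ, ?_⟩, isCMCSurface_level hU hΓ⟩
  rintro γ a b hab ⟨hcont, S, hS, hvel⟩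
  refine quotientMeanCurv_lt hU hΓ ⟨hcont, S, hS, fun t ht htS => ?_⟩ hab subset_rfl
  obtain ⟨e, he, hte, X, hX, htimelike⟩ := hvel t ht htS
  exact ⟨e, he, hte, X, hX, htimelike.isFutureNonspacelike⟩

theorem exists_continuous_lift {γ : ℝ → TorusUniverse Γ U} (hγ : Continuous γ) :
    ∃ c : ℝ → U, Continuous c ∧ ∀ t, proj Γ U (c t) = γ t := by
  let := invariantAction hU hΓ
  obtain ⟨u, hu⟩ := Quotient.exists_rep (γ 0)
  obtain ⟨c, ⟨-, hc⟩, -⟩ :=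
    (isQuotientCoveringMap_proj hU hΓ).isCoveringMap.existsUnique_continuousMap_lifts ⟨γ, hγ⟩ 0 u hu
  exact ⟨c, c.continuous, congrFun hc⟩

theorem exists_lift_strictMono_causalCoord {γ : ℝ → TorusUniverse Γ U}
    (hγ : IsCurveOn (torusCharts Γ U) IsFutureNonspacelike γ Set.univ) :
    ∃ c : ℝ → U, (∀ t, proj Γ U (c t) = γ t) ∧
      ∀ i, StrictMono fun t => causalCoord (mat (c t)) i := by
  obtain ⟨hcont, S, hS, hvel⟩ := hγ
  rw [continuousOn_univ] at hcont
  obtain ⟨c, hc, hcγ⟩ := exists_continuous_lift hU hΓ hcont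
  refine ⟨c, hcγ, fun i => strictMono_of_deriv_pos_off_locallyFinite
    ((continuous_comp_mat hU (contDiffOn_causalCoord i)).comp hc) hS fun t htS => ?_⟩
  obtain ⟨e, he, hte, X, hX, hcausal⟩ := hvel t (by simp) htS
  obtain ⟨z, hz, hzc⟩ := exists_eventually_act_eq_chart hU hΓ he hte
    (continuous_subtype_val.comp hc).continuousAt (.of_forall fun s => ⟨(c s).2, hcγ s⟩)
  obtain ⟨x, y, rfl⟩ := mem_A_iff.1 (hΓ hz)
  have hchart : (fun s => causalCoord (mat (c s)) i) =ᶠ[𝓝 t]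
      fun s => causalCoord (mat (e (γ s))) i - ![x, -x, y, -y] i := by
    filter_upwards [hzc] with s hs
    rw [← hs, Function.comp_apply,
      causalCoord_act_flow (mat_mem_regular (hU.subset_Omega (c s).2)), add_sub_cancel_right]
  obtain ⟨r, hr, hderiv⟩ :=
    exists_hasDerivAt_causalCoord (hU.mem_Omega_chart he hte) rfl hcausal hX i
  rwa [hchart.deriv_eq, (hderiv.sub_const _).deriv]

end Curves

/-! ### Cauchy surfaces -/

theorem exists_tendsto_of_tendsto_causalCoord {g₀ : AdS3} (hg₀ : g₀ ∈ Omega) {l : Filter ℝ}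
    [l.NeBot] {c : ℝ → quadrant g₀}
    (hc : ∀ i, ∃ L, Filter.Tendsto (fun t => causalCoord (mat (c t)) i) l (𝓝 L)) :
    ∃ u, Filter.Tendsto c l (𝓝 u) := by
  choose L hL using hc
  have hκ : Filter.Tendsto (fun t => tanAngle (mat (c t))) l (𝓝 ((L 0 + L 1) / 2)) :=
    (((hL 0).add (hL 1)).div_const 2).congr fun t => by simp [causalCoord]
  have hκ' : Filter.Tendsto (fun t => (tanAngle (mat (c t)))⁻¹) l (𝓝 (-(L 2 + L 3) / 2)) :=
    (((hL 2).add (hL 3)).neg.div_const 2).congr fun t => by simp [causalCoord]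
  have hx : Filter.Tendsto (fun t => coordX (mat (c t))) l (𝓝 ((L 0 - L 1) / 2)) :=
    (((hL 0).sub (hL 1)).div_const 2).congr fun t => by simp [causalCoord]
  have hy : Filter.Tendsto (fun t => coordY (mat (c t))) l (𝓝 ((L 2 - L 3) / 2)) :=
    (((hL 2).sub (hL 3)).div_const 2).congr fun t => by simp [causalCoord]
  set κ := (L 0 + L 1) / 2
  have hκ0 : κ ≠ 0 := by
    have hone : κ * (-(L 2 + L 3) / 2) = 1 := by
      refine tendsto_nhds_unique (hκ.mul hκ') (tendsto_const_nhds.congr fun t => ?_)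
      exact (mul_inv_cancel₀ (tanAngle_ne_zero (mat_mem_regular (c t).2.1))).symm
    exact left_ne_zero_of_mul_eq_one hone
  have hκpos : 0 < κ * tanAngle (mat g₀) :=
    (ge_of_tendsto' (hκ.mul_const _) fun t => (tanAngle_mul_pos (c t).2).le).lt_of_ne'
      (mul_ne_zero hκ0 (tanAngle_ne_zero (mat_mem_regular hg₀)))
  have hcont : Continuous fun p : ℝ × ℝ × ℝ =>
      act (flow p.2.1 p.2.2) (rot (Real.arctan p.1 + halfTurn g₀)) :=
    continuous_act (continuous_flow (by fun_prop) (by fun_prop)) (continuous_rot.comp (by fun_prop))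
  refine ⟨⟨_, act_flow_rot_mem_quadrant hg₀ hκpos ((L 0 - L 1) / 2)
    ((L 2 - L 3) / 2)⟩, tendsto_subtype_rng.2 ?_⟩
  refine ((hcont.tendsto _).comp (hκ.prodMk_nhds (hx.prodMk_nhds hy))).congr fun t => ?_
  rw [Function.comp_apply, ← halfTurn_eq_of_mem_quadrant (c t).2, act_flow_rot (c t).2.1]

section Cauchy

variable {Γ : Subgroup (AdS3 × AdS3)} {g₀ : AdS3} (hg₀ : g₀ ∈ Omega) (hΓ : Γ ≤ A)

theorem orbitImage_eq {g : AdS3} (hg : g ∈ quadrant g₀) :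
    orbitImage Γ (quadrant g₀) g =
      quotientMeanCurv (isOpenInvariant_quadrant g₀) hΓ ⁻¹' {meanCurv (mat g)} := by
  ext q
  constructor
  · rintro ⟨v, hv, rfl⟩
    exact (mem_orbitA_iff_meanCurv_eq hg v.2).1 hv
  · obtain ⟨u, rfl⟩ := Quotient.exists_rep q
    exact fun h => ⟨u, (mem_orbitA_iff_meanCurv_eq hg u.2).2 h, rfl⟩

include hg₀

theorem exists_tendsto_of_tendsto_causalCoord_lift {γ : ℝ → TorusUniverse Γ (quadrant g₀)}
    {c : ℝ → quadrant g₀} (hcγ : ∀ t, proj Γ (quadrant g₀) (c t) = γ t) {l : Filter ℝ} [l.NeBot]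
    (hc : ∀ i, ∃ L, Filter.Tendsto (fun t => causalCoord (mat (c t)) i) l (𝓝 L)) :
    ∃ x, Filter.Tendsto γ l (𝓝 x) := by
  obtain ⟨u, hu⟩ := exists_tendsto_of_tendsto_causalCoord hg₀ hc
  have hproj : Continuous (proj Γ (quadrant g₀)) := continuous_quot_mk
  exact ⟨_, ((hproj.tendsto u).comp hu).congr hcγ⟩

variable [DiscreteTopology Γ]

theorem existsUnique_quotientMeanCurv_eq {γ : ℝ → TorusUniverse Γ (quadrant g₀)}
    (hγ : IsCurveOn (torusCharts Γ (quadrant g₀)) IsFutureNonspacelike γ Set.univ)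
    (htop : ¬ ∃ x, Filter.Tendsto γ Filter.atTop (𝓝 x))
    (hbot : ¬ ∃ x, Filter.Tendsto γ Filter.atBot (𝓝 x)) (k : ℝ) :
    ∃! t, quotientMeanCurv (isOpenInvariant_quadrant g₀) hΓ (γ t) = k := by
  have hU := isOpenInvariant_quadrant g₀
  have hcont : Continuous fun t => quotientMeanCurv hU hΓ (γ t) :=
    (continuous_quotientMeanCurv hU hΓ).comp (continuousOn_univ.1 hγ.1)
  have hmono : StrictMono fun t => quotientMeanCurv hU hΓ (γ t) := fun a b hab =>
    quotientMeanCurv_lt hU hΓ hγ hab (Set.subset_univ _)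
  obtain ⟨c, hcγ, hc⟩ := exists_lift_strictMono_causalCoord hU hΓ hγ
  have hsum (t) : ∑ i, causalCoord (mat (c t)) i = 2 * quotientMeanCurv hU hΓ (γ t) := by
    rw [sum_causalCoord, ← hcγ, quotientMeanCurv_proj]
  have habove : ∃ t, k < quotientMeanCurv hU hΓ (γ t) := by
    by_contra! hle
    refine htop (exists_tendsto_of_tendsto_causalCoord_lift hg₀ hcγ
      (exists_tendsto_atTop_of_sum_bddAbove (fun i => (hc i).monotone) ⟨2 * k, ?_⟩))
    rintro _ ⟨t, rfl⟩
    linarith [hsum t, hle t]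
  have hbelow : ∃ t, quotientMeanCurv hU hΓ (γ t) < k := by
    by_contra! hle
    refine hbot (exists_tendsto_of_tendsto_causalCoord_lift hg₀ hcγ
      (exists_tendsto_atBot_of_sum_bddBelow (fun i => (hc i).monotone) ⟨2 * k, ?_⟩))
    rintro _ ⟨t, rfl⟩
    linarith [hsum t, hle t]
  obtain ⟨a, ha⟩ := hbelow
  obtain ⟨b, hb⟩ := habove
  obtain ⟨t, ht⟩ := mem_range_of_exists_le_of_exists_ge hcont ⟨a, ha.le⟩ ⟨b, hb.le⟩
  exact ⟨t, ht, fun t' ht' => hmono.injective (ht'.trans ht.symm)⟩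

theorem isCauchySurface_level (k : ℝ) :
    IsCauchySurface (torusCharts Γ (quadrant g₀))
      (quotientMeanCurv (isOpenInvariant_quadrant g₀) hΓ ⁻¹' {k}) := by
  refine ⟨isSpacelikeSurface_level _ hΓ k, ?_⟩
  rintro γ ⟨hγ | hγ, htop, hbot⟩
  · exact existsUnique_quotientMeanCurv_eq hg₀ hΓ hγ htop hbot k
  · refine (Equiv.neg ℝ).existsUnique_congr_right.1
      (existsUnique_quotientMeanCurv_eq hg₀ hΓ hγ ?_ ?_ k)
    · exact fun ⟨x, hx⟩ => hbot ⟨x, by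
        simpa [Function.comp_def] using hx.comp Filter.tendsto_neg_atBot_atTop⟩
    · exact fun ⟨x, hx⟩ => htop ⟨x, by
        simpa [Function.comp_def] using hx.comp Filter.tendsto_neg_atTop_atBot⟩

end Cauchy

end AdS

end

theorem theoremp_general (Γ : Subgroup (AdS.AdS3 × AdS.AdS3)) (hΓ : Γ ≤ AdS.A) [DiscreteTopology Γ]
    (U : Set AdS.AdS3) (hU : AdS.IsComponentOfOmega U) :
    (∀ x ∈ Γ, AdS.act x '' U = U) ∧
    AdS.IsSpacetime (AdS.torusCharts Γ U) ∧
    AdS.IsGloballyHyperbolic (AdS.torusCharts Γ U) ∧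
    (∀ g ∈ U, AdS.orbitA g ⊆ U ∧
      (∃! θ : ℝ, θ ∈ Set.Ico 0 (2 * Real.pi) ∧ AdS.rot θ ∈ AdS.orbitA g) ∧
      AdS.IsCauchySurface (AdS.torusCharts Γ U) (AdS.orbitImage Γ U g) ∧
      ∀ θ : ℝ, AdS.rot θ ∈ AdS.orbitA g →
        AdS.IsCMCSurface (AdS.torusCharts Γ U) (AdS.orbitImage Γ U g)
          (-2 * Real.cot (2 * θ))) ∧
    ∃ τ : AdS.TorusUniverse Γ U → ℝ,
      AdS.IsCMCTimeFunction (AdS.torusCharts Γ U) τ ∧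
      ∀ (u : U) (θ : ℝ), AdS.rot θ ∈ AdS.orbitA u.1 →
        τ (AdS.proj Γ U u) = -2 * Real.cot (2 * θ) := by
  obtain ⟨g₀, hg₀, rfl⟩ := hU
  rw [AdS.connectedComponentIn_Omega_eq hg₀]
  have hinv := AdS.isOpenInvariant_quadrant g₀
  have hconn : IsConnected (AdS.quadrant g₀) :=
    ⟨⟨g₀, AdS.mem_quadrant_self hg₀⟩, AdS.isPreconnected_quadrant hg₀⟩
  refine ⟨fun x hx => hinv.act_image (hΓ hx), AdS.isSpacetime_torusCharts hinv hΓ hconn,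
    ⟨_, AdS.isCauchySurface_level hg₀ hΓ 0⟩,
    fun g hg => ⟨?orbit, AdS.existsUnique_rot_mem_orbitA hg.1, ?cauchy, fun θ hθ => ?cmc⟩,
    AdS.quotientMeanCurv hinv hΓ, AdS.isCMCTimeFunction_quotientMeanCurv hinv hΓ,
    fun u θ hθ => AdS.meanCurv_eq_of_rot_mem_orbitA u.2.1 hθ⟩
  case orbit =>
    rintro _ ⟨z, hz, rfl⟩
    exact AdS.act_mem_quadrant hz hg
  case cauchy =>
    rw [AdS.orbitImage_eq hΓ hg]
    exact AdS.isCauchySurface_level hg₀ hΓ _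
  case cmc =>
    rw [AdS.orbitImage_eq hΓ hg, AdS.meanCurv_eq_of_rot_mem_orbitA hg.1 hθ]
    exact AdS.isCMCSurface_level hinv hΓ _

theorem theoremp (Γ : Subgroup (AdS.AdS3 × AdS.AdS3)) (hΓ : AdS.IsLatticeOfA Γ)
    (U : Set AdS.AdS3) (hU : AdS.IsComponentOfOmega U) :
    (∀ x ∈ Γ, AdS.act x '' U = U) ∧
    AdS.IsSpacetime (AdS.torusCharts Γ U) ∧
    AdS.IsGloballyHyperbolic (AdS.torusCharts Γ U) ∧
    (∀ g ∈ U, AdS.orbitA g ⊆ U ∧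
      (∃! θ : ℝ, θ ∈ Set.Ico 0 (2 * Real.pi) ∧ AdS.rot θ ∈ AdS.orbitA g) ∧
      AdS.IsCauchySurface (AdS.torusCharts Γ U) (AdS.orbitImage Γ U g) ∧
      ∀ θ : ℝ, AdS.rot θ ∈ AdS.orbitA g →
        AdS.IsCMCSurface (AdS.torusCharts Γ U) (AdS.orbitImage Γ U g)
          (-2 * Real.cot (2 * θ))) ∧
    ∃ τ : AdS.TorusUniverse Γ U → ℝ,
      AdS.IsCMCTimeFunction (AdS.torusCharts Γ U) τ ∧
      ∀ (u : U) (θ : ℝ), AdS.rot θ ∈ AdS.orbitA u.1 →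
        τ (AdS.proj Γ U u) = -2 * Real.cot (2 * θ) := by
  have := hΓ.discrete
  exact theoremp_general Γ hΓ.le U hU
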